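/- \textbf{Setting.} Let $V$ be a finite set, $G$ a connected simple graph on $V$, and let every edge $e=ab$ of $G$ carry a positive integer label $\alpha_e=\alpha_{ab}$ (a \emph{diffusion pair} $(G,\Delta)$). Let $K$ be a non-archimedean local field of residue characteristic $p$, with residue field of cardinality $q$, with absolute value normalised by $|\pi|_K=q^{-1}$ for a uniformiser $\pi$, with the Haar measure for which $O_K$ has measure $1$, and with a fixed non-trivial continuous additive character $\chi\colon K\to S^1$. Let $\mathscr F$ be the Fourier transform on $L^2(K)$, the continuous extension of $f\mapsto\int_K\chi(\xi x)f(x)\,dx$ from $L^1(K)\cap L^2(K)$, and let $\Delta^{\alpha}=\mathscr F^{-1}|\xi|_K^{\alpha}\mathscr F$ be the Vladimirov operator on its maximal domain. The \emph{$p$-adic Laplacian} $\Lambda_G^\Delta$ of $(G,\Delta)$ is the operator on $L^2(G\times K)=\bigoplus_{a\in V}L^2(K)$ given by $$(\Lambda_G^\Delta u)_a=\sum_{b\sim a}\bigl(\Delta^{\alpha_{ab}}u_a-\Delta^{\alpha_{ab}}u_b\bigr),$$ and $\operatorname{Spec}(\Lambda_G^\Delta)$ is the multiset of its eigenvalues,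 that is, the function which assigns to $\mu\in\mathbb C$ the dimension in $\mathbb N\cup\{\infty\}$ of $\{u:\Lambda_G^\Delta u=\mu u\}$. The \emph{spectral polynomial} $P_G^\Delta(X,Y)\in\mathbb Z[X,Y]$ is the characteristic polynomial, in $X$, of the Laplacian matrix of $G$ with edge weights $Y^{\alpha_e}$. A finite family of labels is called \emph{sum-free} if all its members are positive integers and no label of the family equals a sum of finitely many (not necessarily different) other labels of the family; in particular its members are pairwise different. \textbf{Corollary.} (1) Let $V$ be a finite set and let a sum-free family of labels $\Delta=(\alpha_{ab})$, indexed by the unordered pairs of different elements of $V$, be chosen. Then there is a $p_0$ such that for all primes $p\ge p_0$, all $K$ of residue characteristic $p$ and all $\chi$ as above, every connected simple graph $G$ on $V$ is determined by $\operatorname{Spec}(\Lambda_G^\Delta)$: if $G,G'$ are connected simple graphs on $V$ and $\operatorname{Spec}(\Lambda_G^\Delta)=\operatorname{Spec}(\Lambda_{G'}^\Delta)$, then $G=G'$. In particular, querying the spectra for sufficiently many primes $p$ reconstructs the unknown graph $G$. (2) Let $V,V'$ be finite sets and let $A$ be a finite sum-free set of labels. Then there is a $p_0$ such that for all primes $p\ge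 p_0$, all $K$ of residue characteristic $p$ and all $\chi$ as above, the following holds. Let $G$ and $G'$ be connected simple graphs on $V$ and $V'$ whose edges are labelled by pairwise different elements of $A$ (in an unknown way), with resulting diffusion pairs $(G,\Delta)$ and $(G',\Delta')$. If $\operatorname{Spec}(\Lambda_G^\Delta)=\operatorname{Spec}(\Lambda_{G'}^{\Delta'})$, then $P_G^\Delta=P_{G'}^{\Delta'}$, that is, the spectral curve is recovered. If moreover different subsets of $A$ have different sums, then there is a graph isomorphism $G\cong G'$ which preserves the edge labels. -/

import Mathlib

open MeasureTheory Polynomial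
open scoped ENNReal

namespace PadicLaplacian

noncomputable section

/-! ### Non-archimedean local fields -/

/-- The cardinality `q` of the residue field `O_K / m_K`. -/
def residueCard (K : Type*) [NontriviallyNormedField K] [IsUltrametricDist K] : ℕ :=
  Nat.card (IsLocalRing.ResidueField (NormedField.valuation (K := K)).valuationSubring)

/-- The absolute value of `K` is discrete and normalised: a uniformiser has absolute value
`1 / q`, with `q` the cardinality of the residue field. -/
def IsNormalized (K : Type*) [NontriviallyNormedField K] [IsUltrametricDist K] : Prop :=
  (∃ π : K, ‖π‖ = (residueCard K : ℝ)⁻¹) ∧ ∀ x : K, ‖x‖ < 1 → ‖x‖ ≤ (residueCard K : ℝ)⁻¹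

section Operator

variable (K : Type*) [NontriviallyNormedField K] [IsUltrametricDist K] [ProperSpace K]
  [MeasurableSpace K] [BorelSpace K]

/-- The Haar measure `dx` on `K` for which the ring of integers has measure `1`. -/
def haarK : Measure K :=
  Measure.addHaarMeasure
    { carrier := Metric.closedBall (0 : K) 1
      isCompact' := isCompact_closedBall 0 1
      interior_nonempty' :=
        ⟨0, Metric.ball_subset_interior_closedBall (Metric.mem_ball_self one_pos)⟩ }

/-- The Hilbert space `L²(K)`. -/
abbrev L2 : Type _ := Lp ℂ 2 (haarK K)

variable {K}

/-- The Fourier integral `ξ ↦ ∫ χ(ξ x) f(x) dx`. -/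
def fourierIntegral (χ : AddChar K Circle) (f : K → ℂ) (ξ : K) : ℂ :=
  ∫ x, (χ (ξ * x) : ℂ) * f x ∂(haarK K)

/-- The graph `{(f, ℱ f)}` of the Fourier transform on `L²(K)`: the closure in `L²(K) × L²(K)` of
the graph of the Fourier integral on `L¹(K) ∩ L²(K)`. -/
def fourierGraph (χ : AddChar K Circle) : Submodule ℂ (L2 K × L2 K) :=
  (Submodule.span ℂ {x : L2 K × L2 K |
    Integrable x.1 (haarK K) ∧ x.2 =ᵐ[haarK K] fourierIntegral χ x.1}).topologicalClosure

/-- The graph `{(f, Δ^α f)}` of the Vladimirov operator `Δ^α = ℱ⁻¹ |·|^α ℱ`, whose domain consists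
of the `f ∈ L²(K)` with `|·|^α ℱ f ∈ L²(K)`. -/
def vladimirovGraph (χ : AddChar K Circle) (α : ℕ) : Submodule ℂ (L2 K × L2 K) where
  carrier := {x | ∃ F H : L2 K, (x.1, F) ∈ fourierGraph χ ∧ (x.2, H) ∈ fourierGraph χ ∧
    H =ᵐ[haarK K] fun ξ => (‖ξ‖ ^ α : ℂ) * F ξ}
  zero_mem' := by
    refine ⟨0, 0, (fourierGraph χ).zero_mem, (fourierGraph χ).zero_mem, ?_⟩
    filter_upwards [Lp.coeFn_zero ℂ 2 (haarK K)] with ξ h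
    rw [h, Pi.zero_apply, mul_zero]
  add_mem' := by
    rintro x y ⟨F, H, h1, h2, h3⟩ ⟨F', H', h1', h2', h3'⟩
    refine ⟨F + F', H + H', (fourierGraph χ).add_mem h1 h1', (fourierGraph χ).add_mem h2 h2', ?_⟩
    filter_upwards [h3, h3', Lp.coeFn_add F F', Lp.coeFn_add H H'] with ξ a b c d
    rw [c, d, Pi.add_apply, Pi.add_apply, a, b, mul_add]
  smul_mem' := by
    rintro c x ⟨F, H, h1, h2, h3⟩
    refine ⟨c • F, c • H, (fourierGraph χ).smul_mem c h1, (fourierGraph χ).smul_mem c h2, ?_⟩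
    filter_upwards [h3, Lp.coeFn_smul c F, Lp.coeFn_smul c H] with ξ a b d
    rw [b, d, Pi.smul_apply, Pi.smul_apply, a, smul_eq_mul, smul_eq_mul]
    ring

open Classical in
/-- The graph `{(u, Λ u)}` of the `p`-adic Laplacian of the diffusion pair `(G, Δ)` on
`L²(G × K) = ⨁_{a ∈ V} L²(K_a)`, namely `(Λ u)_a = ∑_{b ∼ a} (Δ^{α_ab} u_a - Δ^{α_ab} u_b)`. The
auxiliary function `d` has the values `d a b = Δ^{α_ab} u_a` and `d b a = Δ^{α_ab} u_b`. -/
def laplacianGraph {V : Type*} [Fintype V] (χ : AddChar K Circle) (G : SimpleGraph V)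
    (Δ : Sym2 V → ℕ) : Submodule ℂ ((V → L2 K) × (V → L2 K)) where
  carrier := {x | ∃ d : V → V → L2 K,
    (∀ a b, G.Adj a b → (x.1 a, d a b) ∈ vladimirovGraph χ (Δ s(a, b))) ∧
    ∀ a, x.2 a = ∑ b, if G.Adj a b then d a b - d b a else 0}
  zero_mem' := ⟨0, fun _ _ _ => Submodule.zero_mem _, fun a => by simp⟩
  add_mem' := by
    rintro x y ⟨d, h1, h2⟩ ⟨d', h1', h2'⟩
    refine ⟨d + d', fun a b h => Submodule.add_mem _ (h1 a b h) (h1' a b h), fun a => ?_⟩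
    rw [Prod.snd_add, Pi.add_apply, h2, h2', ← Finset.sum_add_distrib]
    refine Finset.sum_congr rfl fun b _ => ?_
    split_ifs
    · simp only [Pi.add_apply]; abel
    · simp
  smul_mem' := by
    rintro c x ⟨d, h1, h2⟩
    refine ⟨c • d, fun a b h => Submodule.smul_mem _ c (h1 a b h), fun a => ?_⟩
    rw [Prod.smul_snd, Pi.smul_apply, h2, Finset.smul_sum]
    refine Finset.sum_congr rfl fun b _ => ?_
    split_ifs
    · simp only [Pi.smul_apply, smul_sub]
    · simp

/-- The eigenspace `{u | Λ u = μ u}` of the `p`-adic Laplacian. -/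
def laplacianEigenspace {V : Type*} [Fintype V] (χ : AddChar K Circle) (G : SimpleGraph V)
    (Δ : Sym2 V → ℕ) (μ : ℂ) : Submodule ℂ (V → L2 K) :=
  (laplacianGraph χ G Δ).comap (LinearMap.id.prod (μ • LinearMap.id))

/-- The multiset of eigenvalues of the `p`-adic Laplacian, as the function that sends `μ` to its
multiplicity (`0` if `μ` is not an eigenvalue, `⊤` if the multiplicity is infinite). -/
def laplacianSpec {V : Type*} [Fintype V] (χ : AddChar K Circle) (G : SimpleGraph V)
    (Δ : Sym2 V → ℕ) (μ : ℂ) : ℕ∞ :=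
  Cardinal.toENat (Module.rank ℂ (laplacianEigenspace χ G Δ μ))

end Operator

/-! ### Spectral polynomials and conditions on labels -/

open Classical in
/-- The Laplacian matrix of `G` with edge weights `Y ^ α_e`. -/
def weightedLaplacian {V : Type*} [Fintype V] (G : SimpleGraph V) (Δ : Sym2 V → ℕ) :
    Matrix V V ℤ[X] :=
  Matrix.of fun a b =>
    if a = b then ∑ g, if G.Adj a g then X ^ Δ s(a, g) else 0
    else if G.Adj a b then -X ^ Δ s(a, b) else 0

open Classical in
/-- The spectral polynomial `P(X, Y)` of `(G, Δ)`, as a polynomial in `X` over `ℤ[Y]`; its zero set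
is the affine spectral curve. -/
def spectralPolynomial {V : Type*} [Fintype V] (G : SimpleGraph V) (Δ : Sym2 V → ℕ) : ℤ[X][X] :=
  (weightedLaplacian G Δ).charpoly

/-- The labels `α i`, `i ∈ E`, are positive, and none of them is a sum of finitely many labels
(possibly repeated) at other indices; with one summand this says that they are distinct. -/
def SumFreeLabels {ι : Type*} (E : Set ι) (α : ι → ℕ) : Prop :=
  ∀ i ∈ E, 0 < α i ∧
    ∀ s : Multiset ι, s ≠ 0 → (∀ j ∈ s, j ∈ E ∧ j ≠ i) → α i ≠ (s.map α).sum

/-- Different finite sets of labels have different sums. -/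
def DistinctSubsetSums (A : Set ℕ) : Prop :=
  ∀ S T : Finset ℕ, ↑S ⊆ A → ↑T ⊆ A → ∑ a ∈ S, a = ∑ a ∈ T, a → S = T

/-- The edges of `G` are labelled by pairwise different elements of `A`. -/
def IsLabelling {V : Type*} (A : Set ℕ) (G : SimpleGraph V) (Δ : Sym2 V → ℕ) : Prop :=
  Set.MapsTo Δ G.edgeSet A ∧ Set.InjOn Δ G.edgeSet

/-- Two diffusion pairs are isomorphic: there is a graph isomorphism preserving edge labels. -/
def DiffusionPairIso {V V' : Type*} (G : SimpleGraph V) (Δ : Sym2 V → ℕ)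
    (G' : SimpleGraph V') (Δ' : Sym2 V' → ℕ) : Prop :=
  ∃ φ : G ≃g G', ∀ a b, G.Adj a b → Δ' s(φ a, φ b) = Δ s(a, b)

end

end PadicLaplacian

/-! The Fourier transform turns `Δ^α` into multiplication by `|ξ|^α`, hence the Laplacian into
multiplication by the matrix `L(|ξ|)`, where `L(y)` is the Laplacian matrix of `G` with weights `y ^
Δ e`. On `K \ {0}` the absolute value takes exactly the values `q ^ k`, each on an open sphere. So a
real number is an eigenvalue if and only if it is an eigenvalue of some `L(q ^ k)`, `k ∈ ℤ`
(`laplacianSpec_ne_zero_of_mem_powerSpectrum`, `mem_powerSpectrum_of_laplacianSpec_ne_zero`).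
Multiplicities play no role.

It remains to find, in this union, the spectrum of `L(q ^ k)` for infinitely many single `k`. Since
the labels are distinct, min-max estimates show that for large `y` the eigenvalues of `L(y)` are
simple and each nonzero one lies within a factor `D` of some `y ^ Δ e`
(`exists_spectralSeparation`). For `q > D²`, an eigenvalue of size about `q ^ n` then determines `n
= k * Δ e`. Take `k = r` congruent to `1` modulo the product of all labels: from `k' * Δ e = r * a`
it follows that `Δ e ∣ a`, and sum-freeness, which forbids that one label divides another, gives `Δ
e = a` and `k' = r`. So the spectrum of `L(q ^ r)` is recognisable by size
(`mem_roots_iff_mem_powerSpectrum`). Infinitely many specialisations determine the spectral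
polynomial. As `p ≤ q`, it suffices that `p > D²`.

If the places of the labels are known, the trace, which is twice the sum of the `Y ^ α_e`, shows the
edges. If only the set of labels is known, the characteristic polynomial is multi-affine in the edge
weights. Distinct subset sums keep its monomials apart after the substitution `Y ^ a`, so the
characteristic polynomials of all edge-labelled subgraphs are known
(`charpoly_eq_of_spectralPolynomial_eq`). Eigenvalues of subgraphs with at most three edges tell
which labels meet at a vertex, and this rebuilds the graph in the manner of Whitney's theorem on
line graphs (`diffusionPairIso_of_isLabelEigenvalue_iff`). -/

namespace PadicLaplacian

/-! ### Laplacian matrices with arbitrary edge weights -/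

section EdgeLaplacian

open scoped Classical
open Matrix

variable {V : Type*} [Fintype V] {R : Type*} [CommRing R]

/-- The Laplacian matrix of `G` with edge weights `w`. -/
noncomputable def edgeLaplacian (G : SimpleGraph V) (w : Sym2 V → R) : Matrix V V R :=
  Matrix.of fun a b =>
    if a = b then ∑ g, if G.Adj a g then w s(a, g) else 0
    else if G.Adj a b then -w s(a, b) else 0

theorem weightedLaplacian_eq (G : SimpleGraph V) (Δ : Sym2 V → ℕ) :
    weightedLaplacian G Δ = edgeLaplacian G fun e => (X : ℤ[X]) ^ Δ e := rfl

theorem edgeLaplacian_mulVec (G : SimpleGraph V) (w : Sym2 V → R) (x : V → R) (a : V) :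
    (edgeLaplacian G w *ᵥ x) a = ∑ b, if G.Adj a b then w s(a, b) * (x a - x b) else 0 := by
  have h : ∀ b, edgeLaplacian G w a b * x b =
      (if a = b then (∑ g, if G.Adj a g then w s(a, g) else 0) * x b else 0) -
        (if G.Adj a b then w s(a, b) * x b else 0) := by
    intro b
    by_cases hab : a = b
    · subst hab; simp [edgeLaplacian]
    · simp only [edgeLaplacian, of_apply, hab, if_false]
      split_ifs <;> ring
  rw [mulVec, dotProduct, Finset.sum_congr rfl fun b _ => h b, Finset.sum_sub_distrib,
    Finset.sum_ite_eq, if_pos (Finset.mem_univ a), Finset.sum_mul, ← Finset.sum_sub_distrib]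
  refine Finset.sum_congr rfl fun b _ => ?_
  split_ifs <;> ring

theorem edgeLaplacian_map {S : Type*} [CommRing S] (f : R →+* S) (G : SimpleGraph V)
    (w : Sym2 V → R) : (edgeLaplacian G w).map f = edgeLaplacian G (fun e => f (w e)) := by
  ext a b
  simp only [edgeLaplacian, map_apply, of_apply]
  split_ifs <;> simp [apply_ite f]

theorem edgeLaplacian_congr {G : SimpleGraph V} {w w' : Sym2 V → R}
    (h : ∀ e ∈ G.edgeSet, w e = w' e) : edgeLaplacian G w = edgeLaplacian G w' := by
  ext a b
  have h' : ∀ a b, G.Adj a b → w s(a, b) = w' s(a, b) := fun a b hab => h _ hab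
  have h1 : ∀ g, (if G.Adj a g then w s(a, g) else 0) = if G.Adj a g then w' s(a, g) else 0 := by
    intro g
    split_ifs with hg
    exacts [h' _ _ hg, rfl]
  simp only [edgeLaplacian, of_apply, h1]
  split_ifs with h2 h3
  · rfl
  · rw [h' _ _ h3]
  · rfl

theorem edgeLaplacian_isSymm (G : SimpleGraph V) (w : Sym2 V → R) :
    (edgeLaplacian G w).IsSymm := by
  ext a b
  simp only [edgeLaplacian, transpose_apply, of_apply]
  by_cases hab : a = b
  · subst hab; rfl
  · rw [if_neg hab, if_neg (Ne.symm hab), G.adj_comm, Sym2.eq_swap]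

theorem edgeLaplacian_isHermitian (G : SimpleGraph V) (w : Sym2 V → ℝ) :
    (edgeLaplacian G w).IsHermitian := by
  rw [IsHermitian, conjTranspose_eq_transpose_of_trivial]
  exact edgeLaplacian_isSymm G w

theorem edgeLaplacian_sum {ι : Type*} (s : Finset ι) (G : SimpleGraph V) (w : ι → Sym2 V → R) :
    edgeLaplacian G (fun e => ∑ i ∈ s, w i e) = ∑ i ∈ s, edgeLaplacian G (w i) := by
  ext a b
  simp only [edgeLaplacian, Matrix.sum_apply, of_apply]
  split_ifs
  · rw [Finset.sum_comm]
    refine Finset.sum_congr rfl fun g _ => ?_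
    split_ifs <;> simp
  · simp
  · simp

theorem edgeLaplacian_smul (c : R) (G : SimpleGraph V) (w : Sym2 V → R) :
    edgeLaplacian G (fun e => c * w e) = c • edgeLaplacian G w := by
  ext a b
  simp only [edgeLaplacian, Matrix.smul_apply, of_apply, smul_eq_mul]
  split_ifs
  · rw [Finset.mul_sum]
    refine Finset.sum_congr rfl fun g _ => ?_
    split_ifs <;> simp
  · simp
  · simp

/-- Twice the quadratic form of a weighted Laplacian is a sum of squares of differences. -/
theorem two_mul_dotProduct_edgeLaplacian (G : SimpleGraph V) (w : Sym2 V → R) (x : V → R) :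
    2 * (x ⬝ᵥ edgeLaplacian G w *ᵥ x) =
      ∑ a, ∑ b, if G.Adj a b then w s(a, b) * (x a - x b) ^ 2 else 0 := by
  have h1 : x ⬝ᵥ edgeLaplacian G w *ᵥ x =
      ∑ a, ∑ b, if G.Adj a b then w s(a, b) * (x a * (x a - x b)) else 0 := by
    simp only [dotProduct, edgeLaplacian_mulVec, Finset.mul_sum]
    refine Finset.sum_congr rfl fun a _ => Finset.sum_congr rfl fun b _ => ?_
    split_ifs <;> ring
  have h2 : x ⬝ᵥ edgeLaplacian G w *ᵥ x =
      ∑ a, ∑ b, if G.Adj a b then w s(a, b) * (x b * (x b - x a)) else 0 := by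
    rw [h1, Finset.sum_comm]
    refine Finset.sum_congr rfl fun a _ => Finset.sum_congr rfl fun b _ => ?_
    rw [G.adj_comm, Sym2.eq_swap]
  rw [two_mul]
  nth_rewrite 1 [h1]
  rw [h2, ← Finset.sum_add_distrib]
  refine Finset.sum_congr rfl fun a _ => ?_
  rw [← Finset.sum_add_distrib]
  refine Finset.sum_congr rfl fun b _ => ?_
  split_ifs <;> ring

theorem dotProduct_edgeLaplacian_mono {G : SimpleGraph V} {w w' : Sym2 V → ℝ}
    (h : ∀ e ∈ G.edgeSet, w e ≤ w' e) (x : V → ℝ) :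
    x ⬝ᵥ edgeLaplacian G w *ᵥ x ≤ x ⬝ᵥ edgeLaplacian G w' *ᵥ x := by
  suffices 2 * (x ⬝ᵥ edgeLaplacian G w *ᵥ x) ≤ 2 * (x ⬝ᵥ edgeLaplacian G w' *ᵥ x) by linarith
  rw [two_mul_dotProduct_edgeLaplacian, two_mul_dotProduct_edgeLaplacian]
  refine Finset.sum_le_sum fun a _ => Finset.sum_le_sum fun b _ => ?_
  split_ifs with hab
  · exact mul_le_mul_of_nonneg_right (h _ hab) (sq_nonneg _)
  · exact le_rfl

theorem dotProduct_edgeLaplacian_nonneg {G : SimpleGraph V} {w : Sym2 V → ℝ}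
    (h : ∀ e ∈ G.edgeSet, 0 ≤ w e) (x : V → ℝ) : 0 ≤ x ⬝ᵥ edgeLaplacian G w *ᵥ x := by
  have h0 : edgeLaplacian G (fun _ => (0 : ℝ)) = 0 := by
    ext a b; simp [edgeLaplacian]
  simpa [h0] using dotProduct_edgeLaplacian_mono h x

/-- The quadratic form is a sum of nonnegative terms `w (x a - x b) ^ 2`; when it vanishes, so does
each term. -/
theorem eq_of_edgeLaplacian_mulVec_eq_zero {G : SimpleGraph V} {w : Sym2 V → ℝ}
    (h : ∀ e ∈ G.edgeSet, 0 ≤ w e) {x : V → ℝ} (hx : edgeLaplacian G w *ᵥ x = 0) {a b : V}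
    (hab : G.Adj a b) (hw : 0 < w s(a, b)) : x a = x b := by
  have h0 := two_mul_dotProduct_edgeLaplacian G w x
  rw [hx, dotProduct_zero, mul_zero] at h0
  have hpos : ∀ a b, 0 ≤ if G.Adj a b then w s(a, b) * (x a - x b) ^ 2 else 0 := by
    intro a b
    split_ifs with hab
    · exact mul_nonneg (h _ hab) (sq_nonneg _)
    · exact le_rfl
  have h1 := (Finset.sum_eq_zero_iff_of_nonneg fun a _ =>
    Finset.sum_nonneg fun b _ => hpos a b).1 h0.symm a (Finset.mem_univ a)
  have h2 := (Finset.sum_eq_zero_iff_of_nonneg fun b _ => hpos a b).1 h1 b (Finset.mem_univ b)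
  rw [if_pos hab, mul_eq_zero, sq_eq_zero_iff, sub_eq_zero] at h2
  exact h2.resolve_left hw.ne'

theorem edgeLaplacian_mulVec_eq_zero {G : SimpleGraph V} {w : Sym2 V → R} {x : V → R}
    (h : ∀ a b, G.Adj a b → w s(a, b) = 0 ∨ x a = x b) : edgeLaplacian G w *ᵥ x = 0 := by
  ext a
  rw [edgeLaplacian_mulVec]
  refine Finset.sum_eq_zero fun b _ => ?_
  split_ifs with hab
  · rcases h a b hab with h | h <;> simp [h]
  · rfl

/-- The Laplacian of a single edge has rank one. -/
theorem edgeLaplacian_single {G : SimpleGraph V} {u v : V} (huv : G.Adj u v) :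
    edgeLaplacian G (fun e => if e = s(u, v) then (1 : R) else 0) =
      vecMulVec (Pi.single u 1 - Pi.single v 1) (Pi.single u 1 - Pi.single v 1) := by
  refine Matrix.ext_of_mulVec_single fun j => ?_
  generalize (Pi.single j 1 : V → R) = x
  ext a
  rw [edgeLaplacian_mulVec, vecMulVec_mulVec]
  have huv' := huv.ne
  simp only [sub_dotProduct, single_dotProduct, one_mul, Pi.smul_apply, Pi.sub_apply,
    MulOpposite.smul_eq_mul_unop, MulOpposite.unop_op]
  by_cases hau : a = u
  · subst hau
    rw [Finset.sum_eq_single v]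
    · simp [huv, huv']
    · intro b _ hb
      simp [hb, huv']
    · simp
  by_cases hav : a = v
  · subst hav
    rw [Finset.sum_eq_single u]
    · simp [huv.symm, Ne.symm huv', Sym2.eq_swap]
    · intro b _ hb
      simp [hau, hb]
    · simp
  · rw [Finset.sum_eq_zero]
    · simp [hau, hav]
    · intro b _
      simp [hau, hav]

/-- A label belongs to at most one edge, so its part of the Laplacian has rank at most one, with `b
= 0` for a label that does not occur. This is how distinctness of labels enters both the separation
of eigenvalues and the multi-affine expansion. -/
theorem exists_edgeLaplacian_label (R : Type*) [CommRing R] {G : SimpleGraph V} {Δ : Sym2 V → ℕ}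
    (hΔ : Set.InjOn Δ G.edgeSet) (t : ℕ) :
    ∃ b : V → R, edgeLaplacian G (fun e => if Δ e = t then (1 : R) else 0) = vecMulVec b b := by
  by_cases ht : ∃ e ∈ G.edgeSet, Δ e = t
  · obtain ⟨e, he, rfl⟩ := ht
    induction e with
    | _ u v =>
      refine ⟨_, (edgeLaplacian_congr fun e' he' => ?_).trans (edgeLaplacian_single he)⟩
      simp only [hΔ.eq_iff he' he]
  · push Not at ht
    refine ⟨0, ?_⟩
    rw [vecMulVec_zero]
    refine (edgeLaplacian_congr (w' := fun _ => 0) fun e he => if_neg (ht e he)).trans ?_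
    ext a b
    simp [edgeLaplacian]

/-- Valid over any domain, since a singular matrix has a kernel vector with entries in the ring
itself. It is applied over `ℝ` and over `ℤ`. -/
theorem charpoly_isRoot_iff [IsDomain R] (M : Matrix V V R) (μ : R) :
    M.charpoly.IsRoot μ ↔ ∃ x : V → R, x ≠ 0 ∧ M *ᵥ x = μ • x := by
  rw [Polynomial.IsRoot, eval_charpoly, ← exists_mulVec_eq_zero_iff]
  refine exists_congr fun x => and_congr_right fun _ => ?_
  rw [sub_mulVec, sub_eq_zero, eq_comm]
  simp [scalar_apply, ← smul_one_eq_diagonal, smul_mulVec]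

end EdgeLaplacian

/-! ### Min-max counting of eigenvalues -/

section MinMax

open scoped Classical
open Matrix

variable {V : Type*} [Fintype V] {M : Matrix V V ℝ} (hM : M.IsHermitian)

include hM

theorem sum_sq_dotProduct_eigenvectorBasis (x : V → ℝ) :
    x ⬝ᵥ x = ∑ i, (⇑(hM.eigenvectorBasis i) ⬝ᵥ x) ^ 2 := by
  have h := hM.eigenvectorBasis.sum_inner_mul_inner (WithLp.toLp 2 x) (WithLp.toLp 2 x)
  simp only [EuclideanSpace.inner_eq_star_dotProduct, star_trivial] at h
  rw [← h]
  refine Finset.sum_congr rfl fun i _ => ?_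
  rw [sq, dotProduct_comm x]

theorem dotProduct_eigenvectorBasis_mulVec (i : V) (x : V → ℝ) :
    ⇑(hM.eigenvectorBasis i) ⬝ᵥ M *ᵥ x =
      hM.eigenvalues i * (⇑(hM.eigenvectorBasis i) ⬝ᵥ x) := by
  have hs : Mᵀ = M := by
    rw [← conjTranspose_eq_transpose_of_trivial]; exact hM
  rw [dotProduct_mulVec, ← mulVec_transpose, hs, hM.mulVec_eigenvectorBasis, smul_dotProduct,
    smul_eq_mul]

theorem dotProduct_mulVec_eq_sum_eigenvalues (x : V → ℝ) :
    x ⬝ᵥ M *ᵥ x = ∑ i, hM.eigenvalues i * (⇑(hM.eigenvectorBasis i) ⬝ᵥ x) ^ 2 := by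
  have h := hM.eigenvectorBasis.sum_inner_mul_inner (WithLp.toLp 2 x) (WithLp.toLp 2 (M *ᵥ x))
  simp only [EuclideanSpace.inner_eq_star_dotProduct, star_trivial] at h
  rw [dotProduct_comm, ← h]
  refine Finset.sum_congr rfl fun i _ => ?_
  rw [dotProduct_comm (M *ᵥ x), dotProduct_eigenvectorBasis_mulVec hM]
  ring

/-- The dimension count behind Courant–Fischer: `#J` linear conditions on a space of larger
dimension have a nonzero solution. -/
theorem exists_mem_orthogonal_eigenvectors (W : Submodule ℝ (V → ℝ)) (J : Finset V)
    (h : J.card < Module.finrank ℝ W) :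
    ∃ x ∈ W, x ≠ 0 ∧ ∀ i ∈ J, ⇑(hM.eigenvectorBasis i) ⬝ᵥ x = 0 := by
  let f : (V → ℝ) →ₗ[ℝ] (J → ℝ) :=
    { toFun := fun x i => ⇑(hM.eigenvectorBasis i) ⬝ᵥ x
      map_add' := fun x y => by ext i; simp
      map_smul' := fun c x => by ext i; simp }
  have h1 : (f ∘ₗ W.subtype).ker ≠ ⊥ := LinearMap.ker_ne_bot_of_finrank_lt (by simpa using h)
  obtain ⟨x, hx, hx0⟩ := Submodule.exists_mem_ne_zero_of_ne_bot h1
  refine ⟨x, x.2, fun h => hx0 (Subtype.ext h), fun i hi => ?_⟩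
  exact congrFun (LinearMap.mem_ker.1 hx) ⟨i, hi⟩

theorem exists_dotProduct_eigenvectorBasis_ne_zero {x : V → ℝ} (hx : x ≠ 0) :
    ∃ i, ⇑(hM.eigenvectorBasis i) ⬝ᵥ x ≠ 0 := by
  by_contra! h
  apply hx
  rw [← dotProduct_self_eq_zero, sum_sq_dotProduct_eigenvectorBasis hM]
  simp [h]

/-- If the quadratic form is at least `s` on a subspace `W`, then at least `dim W` eigenvalues are
at least `s`. -/
theorem finrank_le_card_le_eigenvalues (W : Submodule ℝ (V → ℝ)) (s : ℝ)
    (h : ∀ x ∈ W, s * (x ⬝ᵥ x) ≤ x ⬝ᵥ M *ᵥ x) :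
    Module.finrank ℝ W ≤ (Finset.univ.filter fun i => s ≤ hM.eigenvalues i).card := by
  by_contra! hlt
  -- A vector of `W` orthogonal to all eigenvectors with eigenvalue at least `s` has quadratic form
  -- strictly below `s * (x ⬝ᵥ x)`.
  obtain ⟨x, hxW, hx0, hx⟩ := exists_mem_orthogonal_eigenvectors hM W _ hlt
  obtain ⟨j, hj⟩ := exists_dotProduct_eigenvectorBasis_ne_zero hM hx0
  have h1 := h x hxW
  rw [sum_sq_dotProduct_eigenvectorBasis hM x, dotProduct_mulVec_eq_sum_eigenvalues hM,
    Finset.mul_sum] at h1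
  refine absurd h1 (not_le.2 (Finset.sum_lt_sum (fun i _ => ?_) ⟨j, Finset.mem_univ j, ?_⟩))
  · by_cases hi : s ≤ hM.eigenvalues i
    · simp [hx i (by simpa using hi)]
    · exact mul_le_mul_of_nonneg_right (not_le.1 hi).le (sq_nonneg _)
  · have : ¬ s ≤ hM.eigenvalues j := fun h' => hj (hx j (by simpa using h'))
    exact mul_lt_mul_of_pos_right (not_le.1 this) (by positivity)

/-- If the quadratic form is at most `s` on a subspace `W`, then at least `dim W` eigenvalues are
at most `s`. -/
theorem finrank_le_card_eigenvalues_le (W : Submodule ℝ (V → ℝ)) (s : ℝ)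
    (h : ∀ x ∈ W, x ⬝ᵥ M *ᵥ x ≤ s * (x ⬝ᵥ x)) :
    Module.finrank ℝ W ≤ (Finset.univ.filter fun i => hM.eigenvalues i ≤ s).card := by
  by_contra! hlt
  obtain ⟨x, hxW, hx0, hx⟩ := exists_mem_orthogonal_eigenvectors hM W _ hlt
  obtain ⟨j, hj⟩ := exists_dotProduct_eigenvectorBasis_ne_zero hM hx0
  have h1 := h x hxW
  rw [sum_sq_dotProduct_eigenvectorBasis hM x, dotProduct_mulVec_eq_sum_eigenvalues hM,
    Finset.mul_sum] at h1
  refine absurd h1 (not_le.2 (Finset.sum_lt_sum (fun i _ => ?_) ⟨j, Finset.mem_univ j, ?_⟩))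
  · by_cases hi : hM.eigenvalues i ≤ s
    · simp [hx i (by simpa using hi)]
    · exact mul_le_mul_of_nonneg_right (not_le.1 hi).le (sq_nonneg _)
  · have : ¬ hM.eigenvalues j ≤ s := fun h' => hj (hx j (by simpa using h'))
    exact mul_lt_mul_of_pos_right (not_le.1 this) (by positivity)

theorem exists_dotProduct_mulVec_le :
    ∃ C : ℝ, 0 ≤ C ∧ ∀ x : V → ℝ, x ⬝ᵥ M *ᵥ x ≤ C * (x ⬝ᵥ x) := by
  refine ⟨∑ i, |hM.eigenvalues i|, Finset.sum_nonneg fun i _ => abs_nonneg _, fun x => ?_⟩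
  rw [dotProduct_mulVec_eq_sum_eigenvalues hM, sum_sq_dotProduct_eigenvectorBasis hM x,
    Finset.mul_sum]
  refine Finset.sum_le_sum fun i _ => mul_le_mul_of_nonneg_right ?_ (sq_nonneg _)
  exact (le_abs_self _).trans
    (Finset.single_le_sum (fun j _ => abs_nonneg (hM.eigenvalues j)) (Finset.mem_univ i))

/-- A positive semidefinite form is positive definite on its range. -/
theorem eventually_mul_le_dotProduct_mulVec (h0 : ∀ x : V → ℝ, 0 ≤ x ⬝ᵥ M *ᵥ x) :
    ∀ᶠ c in nhdsWithin (0 : ℝ) (Set.Ioi 0), ∀ z : V → ℝ,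
      c * ((M *ᵥ z) ⬝ᵥ (M *ᵥ z)) ≤ (M *ᵥ z) ⬝ᵥ M *ᵥ (M *ᵥ z) := by
  have hpos : ∀ i, 0 ≤ hM.eigenvalues i := by
    intro i
    have := h0 ⇑(hM.eigenvectorBasis i)
    rw [hM.eigenvalues_eq i]
    simpa using this
  have h1 : ∀ᶠ c in nhdsWithin (0 : ℝ) (Set.Ioi 0), ∀ i, hM.eigenvalues i ≠ 0 →
      c ≤ hM.eigenvalues i := by
    refine Filter.eventually_all.2 fun i => ?_
    by_cases hi : hM.eigenvalues i = 0
    · simp [hi]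
    · filter_upwards [Ioc_mem_nhdsGT ((hpos i).lt_of_ne' hi)] with c hc _ using hc.2
  filter_upwards [h1] with c hc z
  rw [sum_sq_dotProduct_eigenvectorBasis hM (M *ᵥ z),
    dotProduct_mulVec_eq_sum_eigenvalues hM (M *ᵥ z), Finset.mul_sum]
  refine Finset.sum_le_sum fun i _ => ?_
  -- A vector in the range has no component along the kernel, so only positive eigenvalues matter,
  -- and `c` lies below all of them.
  by_cases hi : hM.eigenvalues i = 0
  · simp [dotProduct_eigenvectorBasis_mulVec hM, hi]
  · exact mul_le_mul_of_nonneg_right (hc i hi) (sq_nonneg _)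

end MinMax

/-! ### Separation of the eigenvalues of `L(y)` for large `y` -/

section Separation

open scoped Classical
open Matrix

variable {V : Type*} [Fintype V]

/-- The Laplacian matrix of `G` with edge weights `y ^ Δ e`, for real `y`. -/
noncomputable def realLaplacian (G : SimpleGraph V) (Δ : Sym2 V → ℕ) (y : ℝ) : Matrix V V ℝ :=
  edgeLaplacian G fun e => y ^ Δ e

/-- The unweighted Laplacian matrix of the subgraph of the edges with label at least `t`. -/
noncomputable def thresholdLaplacian (G : SimpleGraph V) (Δ : Sym2 V → ℕ) (t : ℕ) :
    Matrix V V ℝ :=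
  edgeLaplacian G fun e => if t ≤ Δ e then 1 else 0

theorem realLaplacian_isHermitian (G : SimpleGraph V) (Δ : Sym2 V → ℕ) (y : ℝ) :
    (realLaplacian G Δ y).IsHermitian := edgeLaplacian_isHermitian G _

/-- With constant `D`, the Laplacians `L(y)` with `y ≥ D` have distinct eigenvalues, every nonzero
one of which is comparable to `y ^ Δ e` for some edge `e`; those with `y ≤ 1` are bounded. -/
structure SpectralSeparation (G : SimpleGraph V) (Δ : Sym2 V → ℕ) (D : ℝ) : Prop where
  one_le : 1 ≤ D
  le_of_le_one : ∀ y : ℝ, 0 < y → y ≤ 1 → ∀ μ ∈ (realLaplacian G Δ y).charpoly.roots, μ ≤ D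
  nodup : ∀ y : ℝ, D ≤ y → (realLaplacian G Δ y).charpoly.roots.Nodup
  comparable : ∀ y : ℝ, D ≤ y → ∀ μ ∈ (realLaplacian G Δ y).charpoly.roots, μ = 0 ∨
    ∃ e ∈ G.edgeSet, y ^ Δ e ≤ D * μ ∧ μ ≤ D * y ^ Δ e

theorem thresholdLaplacian_nonneg (G : SimpleGraph V) (Δ : Sym2 V → ℕ) (t : ℕ) (x : V → ℝ) :
    0 ≤ x ⬝ᵥ thresholdLaplacian G Δ t *ᵥ x :=
  dotProduct_edgeLaplacian_nonneg (fun e _ => by positivity) x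

/-- One constant serves all `t`: beyond the largest label the matrix is zero, and finitely many
thresholds remain. -/
theorem exists_threshold_gap (G : SimpleGraph V) (Δ : Sym2 V → ℕ) :
    ∃ c : ℝ, 0 < c ∧ ∀ t, ∀ x ∈ (thresholdLaplacian G Δ t).mulVecLin.range,
      c * (x ⬝ᵥ x) ≤ x ⬝ᵥ thresholdLaplacian G Δ t *ᵥ x := by
  obtain ⟨N, hN⟩ : ∃ N, ∀ e ∈ (Set.univ : Set (Sym2 V)), Δ e ≤ N := by
    obtain ⟨N, hN⟩ := (Set.finite_range Δ).bddAbove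
    exact ⟨N, fun e _ => hN ⟨e, rfl⟩⟩
  have h1 : ∀ᶠ c in nhdsWithin (0 : ℝ) (Set.Ioi 0), ∀ t ∈ Finset.range (N + 1), ∀ z : V → ℝ,
      c * ((thresholdLaplacian G Δ t *ᵥ z) ⬝ᵥ (thresholdLaplacian G Δ t *ᵥ z)) ≤
        (thresholdLaplacian G Δ t *ᵥ z) ⬝ᵥ thresholdLaplacian G Δ t *ᵥ
          (thresholdLaplacian G Δ t *ᵥ z) :=
    (Finset.eventually_all _).2 fun t _ =>
      eventually_mul_le_dotProduct_mulVec (edgeLaplacian_isHermitian G _)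
        (thresholdLaplacian_nonneg G Δ t)
  obtain ⟨c, hc, hc0⟩ := (h1.and self_mem_nhdsWithin).exists
  refine ⟨c, hc0, ?_⟩
  rintro t x ⟨z, rfl⟩
  rw [mulVecLin_apply]
  by_cases ht : t ∈ Finset.range (N + 1)
  · exact hc t ht z
  · have h0 : thresholdLaplacian G Δ t *ᵥ z = 0 := by
      refine edgeLaplacian_mulVec_eq_zero fun a b _ => Or.inl (if_neg ?_)
      have := hN s(a, b) trivial
      simp only [Finset.mem_range] at ht
      omega
    simp [h0]

theorem rank_add_finrank_ker (M : Matrix V V ℝ) :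
    M.rank + Module.finrank ℝ M.mulVecLin.ker = Fintype.card V := by
  rw [Matrix.rank, LinearMap.finrank_range_add_finrank_ker, Module.finrank_pi]

theorem rank_add_le_rank_add_rank (M N : Matrix V V ℝ) : (M + N).rank ≤ M.rank + N.rank := by
  rw [Matrix.rank, Matrix.rank, Matrix.rank, mulVecLin_add]
  exact (Submodule.finrank_mono (LinearMap.range_add_le _ _)).trans
    (Submodule.finrank_add_le_finrank_add_finrank _ _)

/-- Passing from `t + 1` to `t` adds only the edges with label exactly `t`, of which there is at
most one. -/
theorem rank_thresholdLaplacian_le {G : SimpleGraph V} {Δ : Sym2 V → ℕ}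
    (hΔ : Set.InjOn Δ G.edgeSet) (t : ℕ) :
    (thresholdLaplacian G Δ t).rank ≤ (thresholdLaplacian G Δ (t + 1)).rank + 1 := by
  have h : thresholdLaplacian G Δ t = thresholdLaplacian G Δ (t + 1) +
      edgeLaplacian G (fun e => if Δ e = t then (1 : ℝ) else 0) := by
    have h2 := edgeLaplacian_sum (Finset.univ : Finset Bool) G (fun i e =>
      if i then (if t + 1 ≤ Δ e then (1 : ℝ) else 0) else if Δ e = t then (1 : ℝ) else 0)
    simp only [Fintype.sum_bool, if_true, Bool.false_eq_true, if_false] at h2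
    rw [thresholdLaplacian, thresholdLaplacian, ← h2]
    refine edgeLaplacian_congr fun e _ => ?_
    rcases lt_trichotomy t (Δ e) with h | h | h
    · simp [h, h.le, h.ne']
    · simp [h]
    · simp [h.not_ge, h.ne, h.le]
  obtain ⟨b, hb⟩ := exists_edgeLaplacian_label ℝ hΔ t
  rw [h, hb]
  exact (rank_add_le_rank_add_rank _ _).trans (Nat.add_le_add_left (rank_vecMulVec_le _ _) _)

theorem exists_edge_of_rank_ne {G : SimpleGraph V} {Δ : Sym2 V → ℕ} {t : ℕ}
    (h : (thresholdLaplacian G Δ t).rank ≠ (thresholdLaplacian G Δ (t + 1)).rank) :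
    ∃ e ∈ G.edgeSet, Δ e = t := by
  by_contra! hne
  refine h (congrArg Matrix.rank (edgeLaplacian_congr fun e he => ?_))
  have := hne e he
  exact if_congr (by omega) rfl rfl

/-- As quadratic forms, `L(y)` dominates `y ^ t` times the threshold Laplacian, which is at least
`c` on its range. -/
theorem rank_le_card_le_eigenvalues (G : SimpleGraph V) (Δ : Sym2 V → ℕ) {c : ℝ} (t : ℕ)
    (hc : ∀ x ∈ (thresholdLaplacian G Δ t).mulVecLin.range,
      c * (x ⬝ᵥ x) ≤ x ⬝ᵥ thresholdLaplacian G Δ t *ᵥ x) {y : ℝ} (hy : 1 ≤ y) :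
    (thresholdLaplacian G Δ t).rank ≤ (Finset.univ.filter fun i =>
      c * y ^ t ≤ (realLaplacian_isHermitian G Δ y).eigenvalues i).card := by
  refine finrank_le_card_le_eigenvalues _ _ _ fun x hx => ?_
  have h1 : y ^ t * (x ⬝ᵥ thresholdLaplacian G Δ t *ᵥ x) ≤ x ⬝ᵥ realLaplacian G Δ y *ᵥ x := by
    rw [← smul_eq_mul (y ^ t), ← dotProduct_smul, ← smul_mulVec, thresholdLaplacian,
      ← edgeLaplacian_smul]
    refine dotProduct_edgeLaplacian_mono (fun e _ => ?_) x
    split_ifs with h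
    · simpa using pow_le_pow_right₀ hy h
    · simpa using pow_nonneg (by linarith) _
  have h2 := mul_le_mul_of_nonneg_left (hc x hx) (by positivity : 0 ≤ y ^ t)
  linarith

/-- Vectors in the kernel of the threshold Laplacian at `t + 1` are constant along all edges with
larger label than `t`. On them only weights at most `y ^ t` contribute, and `thresholdLaplacian G Δ
0` is the unweighted Laplacian of all of `G`. -/
theorem card_le_rank_add_card (G : SimpleGraph V) (Δ : Sym2 V → ℕ) {C : ℝ} (t : ℕ)
    (hC : ∀ x : V → ℝ, x ⬝ᵥ thresholdLaplacian G Δ 0 *ᵥ x ≤ C * (x ⬝ᵥ x)) {y : ℝ} (hy : 1 ≤ y) :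
    Fintype.card V ≤ (thresholdLaplacian G Δ (t + 1)).rank + (Finset.univ.filter fun i =>
      (realLaplacian_isHermitian G Δ y).eigenvalues i ≤ C * y ^ t).card := by
  rw [← rank_add_finrank_ker (thresholdLaplacian G Δ (t + 1))]
  refine Nat.add_le_add_left (finrank_le_card_eigenvalues_le _ _ _ fun x hx => ?_) _
  have hx' : ∀ a b, G.Adj a b → t + 1 ≤ Δ s(a, b) → x a = x b := fun a b hab h =>
    eq_of_edgeLaplacian_mulVec_eq_zero (w := fun e => if t + 1 ≤ Δ e then (1 : ℝ) else 0)
      (fun e _ => by positivity) hx hab (by simp [h])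
  have h1 : realLaplacian G Δ y *ᵥ x =
      edgeLaplacian G (fun e => if t + 1 ≤ Δ e then 0 else y ^ Δ e) *ᵥ x := by
    ext a
    rw [realLaplacian, edgeLaplacian_mulVec, edgeLaplacian_mulVec]
    refine Finset.sum_congr rfl fun b _ => ?_
    split_ifs with hab h
    · simp [hx' a b hab h]
    · rfl
    · rfl
  have h2 : x ⬝ᵥ realLaplacian G Δ y *ᵥ x ≤ y ^ t * (x ⬝ᵥ thresholdLaplacian G Δ 0 *ᵥ x) := by
    rw [← smul_eq_mul (y ^ t), ← dotProduct_smul, ← smul_mulVec, thresholdLaplacian,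
      ← edgeLaplacian_smul, h1]
    refine dotProduct_edgeLaplacian_mono (fun e _ => ?_) x
    split_ifs with h
    · positivity
    · simp_all
    · simpa using pow_le_pow_right₀ hy (by omega)
    · simp_all
  have h3 := mul_le_mul_of_nonneg_left (hC x) (by positivity : 0 ≤ y ^ t)
  linarith

/-- All labels are at least `1`, so at threshold `1` every edge is kept, and on a connected graph
the kernel consists of the constants. -/
theorem card_le_rank_one_add_one {G : SimpleGraph V} (hG : G.Connected) {Δ : Sym2 V → ℕ}
    (hpos : ∀ e ∈ G.edgeSet, 0 < Δ e) :
    Fintype.card V ≤ (thresholdLaplacian G Δ 1).rank + 1 := by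
  rw [← rank_add_finrank_ker (thresholdLaplacian G Δ 1)]
  refine Nat.add_le_add_left ?_ _
  obtain ⟨v⟩ := hG.nonempty
  have h1 : (fun _ => 1 : V → ℝ) ∈ (thresholdLaplacian G Δ 1).mulVecLin.ker :=
    edgeLaplacian_mulVec_eq_zero fun a b _ => Or.inr rfl
  refine finrank_le_one ⟨_, h1⟩ fun w => ⟨w.1 v, Subtype.ext (funext fun u => ?_)⟩
  obtain ⟨p⟩ := hG.preconnected v u
  have key : ∀ {a b : V}, G.Walk a b → w.1 a = w.1 b := by
    intro a b p
    induction p with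
    | nil => rfl
    | cons h _ ih =>
      rw [← ih]
      exact eq_of_edgeLaplacian_mulVec_eq_zero (w := fun e => if 1 ≤ Δ e then (1 : ℝ) else 0)
        (fun e _ => by positivity) w.2 h (by rw [if_pos (show 1 ≤ Δ _ from hpos _ h)]; exact one_pos)
  simpa using key p

theorem realLaplacian_eigenvalues_nonneg (G : SimpleGraph V) (Δ : Sym2 V → ℕ) {y : ℝ}
    (hy : 0 ≤ y) (i : V) : 0 ≤ (realLaplacian_isHermitian G Δ y).eigenvalues i := by
  rw [IsHermitian.eigenvalues_eq]
  simpa using! dotProduct_edgeLaplacian_nonneg (G := G) (w := fun e => y ^ Δ e)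
    (fun e _ => by positivity) _

theorem one_le_card_eigenvalues_le_zero [Nonempty V] (G : SimpleGraph V) (Δ : Sym2 V → ℕ)
    (y : ℝ) : 1 ≤ (Finset.univ.filter fun i =>
      (realLaplacian_isHermitian G Δ y).eigenvalues i ≤ 0).card := by
  have h1 : (fun _ => 1 : V → ℝ) ≠ 0 := fun h => one_ne_zero (congrFun h (Classical.arbitrary V))
  rw [← finrank_span_singleton (K := ℝ) h1]
  refine finrank_le_card_eigenvalues_le _ _ _ fun x hx => ?_
  obtain ⟨r, rfl⟩ := Submodule.mem_span_singleton.1 hx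
  rw [realLaplacian, edgeLaplacian_mulVec_eq_zero fun a b _ => Or.inr rfl]
  simp

section Bands

variable {G : SimpleGraph V} {Δ : Sym2 V → ℕ} {c C y : ℝ}

/-- The lower and the upper count add up to at least the number of vertices, while `C < c * y` makes
the two groups of eigenvalues disjoint. Hence both counts are exact and no eigenvalue lies in
between. -/
theorem eigenvalues_threshold_dichotomy
    (hc : ∀ t, ∀ x ∈ (thresholdLaplacian G Δ t).mulVecLin.range,
      c * (x ⬝ᵥ x) ≤ x ⬝ᵥ thresholdLaplacian G Δ t *ᵥ x)
    (hC : ∀ x : V → ℝ, x ⬝ᵥ thresholdLaplacian G Δ 0 *ᵥ x ≤ C * (x ⬝ᵥ x))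
    (hy : 1 ≤ y) (hcy : C < c * y) (t : ℕ) :
    (Finset.univ.filter fun i =>
      c * y ^ (t + 1) ≤ (realLaplacian_isHermitian G Δ y).eigenvalues i).card =
        (thresholdLaplacian G Δ (t + 1)).rank ∧
    ∀ i, c * y ^ (t + 1) ≤ (realLaplacian_isHermitian G Δ y).eigenvalues i ∨
      (realLaplacian_isHermitian G Δ y).eigenvalues i ≤ C * y ^ t := by
  have h1 := rank_le_card_le_eigenvalues G Δ (t + 1) (hc _) hy
  have h2 := card_le_rank_add_card G Δ t hC hy
  set ev := (realLaplacian_isHermitian G Δ y).eigenvalues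
  have hlt : C * y ^ t < c * y ^ (t + 1) := by
    rw [pow_succ', ← mul_assoc]
    exact mul_lt_mul_of_pos_right hcy (by positivity)
  have hd : Disjoint (Finset.univ.filter fun i => c * y ^ (t + 1) ≤ ev i)
      (Finset.univ.filter fun i => ev i ≤ C * y ^ t) := by
    rw [Finset.disjoint_filter]
    exact fun i _ h h' => absurd (h.trans h') (not_le.2 hlt)
  have h3 := Finset.card_union_of_disjoint hd
  have h4 := Finset.card_le_univ ((Finset.univ.filter fun i => c * y ^ (t + 1) ≤ ev i) ∪
    (Finset.univ.filter fun i => ev i ≤ C * y ^ t))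
  refine ⟨by omega, fun i => ?_⟩
  have h5 : ((Finset.univ.filter fun i => c * y ^ (t + 1) ≤ ev i) ∪
      (Finset.univ.filter fun i => ev i ≤ C * y ^ t)) = Finset.univ :=
    (Finset.card_eq_iff_eq_univ _).1 (by omega)
  have h6 := Finset.mem_univ i
  rw [← h5] at h6
  simpa using h6

theorem eigenvalues_zero_dichotomy (hG : G.Connected) (hpos : ∀ e ∈ G.edgeSet, 0 < Δ e)
    (hc0 : 0 < c) (hc : ∀ t, ∀ x ∈ (thresholdLaplacian G Δ t).mulVecLin.range,
      c * (x ⬝ᵥ x) ≤ x ⬝ᵥ thresholdLaplacian G Δ t *ᵥ x) (hy : 1 ≤ y) :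
    (Finset.univ.filter fun i =>
      (realLaplacian_isHermitian G Δ y).eigenvalues i ≤ 0).card = 1 ∧
    ∀ i, c * y ≤ (realLaplacian_isHermitian G Δ y).eigenvalues i ∨
      (realLaplacian_isHermitian G Δ y).eigenvalues i ≤ 0 := by
  have := hG.nonempty
  have h1 := rank_le_card_le_eigenvalues G Δ 1 (hc _) hy
  rw [pow_one] at h1
  have h2 := card_le_rank_one_add_one hG hpos
  have h0 := one_le_card_eigenvalues_le_zero G Δ y
  set ev := (realLaplacian_isHermitian G Δ y).eigenvalues
  have hd : Disjoint (Finset.univ.filter fun i => c * y ≤ ev i)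
      (Finset.univ.filter fun i => ev i ≤ 0) := by
    rw [Finset.disjoint_filter]
    exact fun i _ h h' => absurd (h.trans h') (not_le.2 (by positivity))
  have h3 := Finset.card_union_of_disjoint hd
  have h4 := Finset.card_le_univ ((Finset.univ.filter fun i => c * y ≤ ev i) ∪
    (Finset.univ.filter fun i => ev i ≤ 0))
  refine ⟨by omega, fun i => ?_⟩
  have h5 : ((Finset.univ.filter fun i => c * y ≤ ev i) ∪
      (Finset.univ.filter fun i => ev i ≤ 0)) = Finset.univ :=
    (Finset.card_eq_iff_eq_univ _).1 (by omega)
  have h6 := Finset.mem_univ i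
  rw [← h5] at h6
  simpa using h6

/-- Every nonzero eigenvalue lies in the band of a label, and every band contains only one. -/
theorem eigenvalues_bands (hG : G.Connected) (hpos : ∀ e ∈ G.edgeSet, 0 < Δ e)
    (hΔ : Set.InjOn Δ G.edgeSet)
    (hc0 : 0 < c) (hc : ∀ t, ∀ x ∈ (thresholdLaplacian G Δ t).mulVecLin.range,
      c * (x ⬝ᵥ x) ≤ x ⬝ᵥ thresholdLaplacian G Δ t *ᵥ x)
    (hC : ∀ x : V → ℝ, x ⬝ᵥ thresholdLaplacian G Δ 0 *ᵥ x ≤ C * (x ⬝ᵥ x))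
    (hy : 1 < y) (hcy : C < c * y) (i : V)
    (hi : (realLaplacian_isHermitian G Δ y).eigenvalues i ≠ 0) :
    ∃ e ∈ G.edgeSet, c * y ^ Δ e ≤ (realLaplacian_isHermitian G Δ y).eigenvalues i ∧
      (realLaplacian_isHermitian G Δ y).eigenvalues i ≤ C * y ^ Δ e ∧
      ∀ j, (realLaplacian_isHermitian G Δ y).eigenvalues j =
        (realLaplacian_isHermitian G Δ y).eigenvalues i → j = i := by
  have hdich := eigenvalues_threshold_dichotomy hc hC hy.le hcy
  have hzero := (eigenvalues_zero_dichotomy hG hpos hc0 hc hy.le).2 i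
  have hnn := realLaplacian_eigenvalues_nonneg G Δ (zero_le_one.trans hy.le) i
  set ev := (realLaplacian_isHermitian G Δ y).eigenvalues
  have h1 : c * y ≤ ev i := hzero.resolve_right fun h => hi (le_antisymm h hnn)
  have hex : ∃ t, ev i < c * y ^ t := by
    obtain ⟨t, ht⟩ := pow_unbounded_of_one_lt (ev i / c) hy
    exact ⟨t, by rwa [div_lt_iff₀' hc0] at ht⟩
  -- The least `t` with `ev i < c * y ^ t` is at least `2` because a nonzero eigenvalue is at least
  -- `c * y`.
  obtain ⟨s, hs⟩ : ∃ s, Nat.find hex = s + 2 := by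
    rcases h : Nat.find hex with _ | _ | s
    · have := Nat.find_spec hex
      rw [h, pow_zero] at this
      nlinarith
    · have := Nat.find_spec hex
      rw [h, zero_add, pow_one] at this
      exact absurd this (not_lt.2 h1)
    · exact ⟨s, rfl⟩
  have hlt : ev i < c * y ^ (s + 1 + 1) := by
    have := Nat.find_spec hex
    rwa [hs] at this
  have hle : c * y ^ (s + 1) ≤ ev i := not_lt.1 (Nat.find_min hex (by omega))
  -- The numbers of eigenvalues above `c * y ^ (s + 1)` and above `c * y ^ (s + 2)` are the ranks at
  -- consecutive thresholds. They differ by at most one, and since `ev i` lies in between, they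
  -- differ by exactly one: `s + 1` is a label and `ev i` is simple.
  have hsub : (Finset.univ.filter fun j => c * y ^ (s + 1 + 1) ≤ ev j) ∪
      (Finset.univ.filter fun j => ev j = ev i) ⊆
      Finset.univ.filter fun j => c * y ^ (s + 1) ≤ ev j := by
    intro j hj
    simp only [Finset.mem_union, Finset.mem_filter, Finset.mem_univ, true_and] at hj ⊢
    rcases hj with hj | hj
    · refine le_trans (mul_le_mul_of_nonneg_left ?_ hc0.le) hj
      exact pow_le_pow_right₀ hy.le (by omega)
    · rwa [hj]
  have hd : Disjoint (Finset.univ.filter fun j => c * y ^ (s + 1 + 1) ≤ ev j)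
      (Finset.univ.filter fun j => ev j = ev i) := by
    rw [Finset.disjoint_filter]
    intro j _ h h'
    rw [h'] at h
    exact absurd h (not_le.2 hlt)
  have h2 := Finset.card_le_card hsub
  rw [Finset.card_union_of_disjoint hd, (hdich s).1, (hdich (s + 1)).1] at h2
  have h3 : 0 < (Finset.univ.filter fun j => ev j = ev i).card :=
    Finset.card_pos.2 ⟨i, by simp⟩
  have h4 := rank_thresholdLaplacian_le hΔ (s + 1)
  obtain ⟨e, he, hes⟩ := exists_edge_of_rank_ne (G := G) (Δ := Δ) (t := s + 1) (by omega)
  refine ⟨e, he, hes ▸ hle, hes ▸ ((hdich (s + 1)).2 i).resolve_left (not_le.2 hlt), ?_⟩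
  intro j hj
  exact Finset.card_le_one.1 (by omega : (Finset.univ.filter fun j => ev j = ev i).card ≤ 1) j
    (by simp [hj]) i (by simp)

end Bands

theorem mem_roots_charpoly_realLaplacian {G : SimpleGraph V} {Δ : Sym2 V → ℕ} {y μ : ℝ} :
    μ ∈ (realLaplacian G Δ y).charpoly.roots ↔
      ∃ i, (realLaplacian_isHermitian G Δ y).eigenvalues i = μ := by
  rw [(realLaplacian_isHermitian G Δ y).roots_charpoly_eq_eigenvalues]
  simp

theorem exists_spectralSeparation {G : SimpleGraph V} (hG : G.Connected) {Δ : Sym2 V → ℕ}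
    (hpos : ∀ e ∈ G.edgeSet, 0 < Δ e) (hΔ : Set.InjOn Δ G.edgeSet) :
    ∃ D₀ : ℝ, ∀ D, D₀ ≤ D → SpectralSeparation G Δ D := by
  obtain ⟨c, hc0, hc⟩ := exists_threshold_gap G Δ
  obtain ⟨C, hC0, hC⟩ := exists_dotProduct_mulVec_le
    (edgeLaplacian_isHermitian G fun e => if 0 ≤ Δ e then (1 : ℝ) else 0)
  -- The four quantities ensure, for `y ≥ D`, that `y > 1`, that `C` and `1 / c` are at most `D`
  -- (the two comparison constants), and that `C < c * y`.
  refine ⟨max 2 (max C ((C + 1) / c)) + 1 / c, fun D hD => ?_⟩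
  have hc1 : 0 < 1 / c := by positivity
  have hD2 : 2 ≤ D := by
    have := le_max_left 2 (max C ((C + 1) / c)); linarith
  have hDC : C ≤ D := by
    have := (le_max_left C ((C + 1) / c)).trans (le_max_right 2 _); linarith
  have hDc : (C + 1) / c ≤ D := by
    have := (le_max_right C ((C + 1) / c)).trans (le_max_right 2 _); linarith
  have hDc1 : 1 / c ≤ D := by
    have := le_max_left 2 (max C ((C + 1) / c)); linarith
  have hcy : ∀ y, D ≤ y → C < c * y := by
    intro y hy
    have := (div_le_iff₀' hc0).1 (hDc.trans hy)
    linarith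
  refine ⟨by linarith, ?_, ?_, ?_⟩
  · intro y hy0 hy1 μ hμ
    obtain ⟨i, rfl⟩ := mem_roots_charpoly_realLaplacian.1 hμ
    refine le_trans ?_ hDC
    have h1 := finrank_le_card_eigenvalues_le (realLaplacian_isHermitian G Δ y) ⊤ C
      fun x _ => le_trans (dotProduct_edgeLaplacian_mono (fun e _ => by
        simpa using pow_le_one₀ hy0.le hy1) x) (hC x)
    rw [finrank_top, Module.finrank_pi] at h1
    have h2 := (Finset.card_eq_iff_eq_univ _).1 (le_antisymm (Finset.card_le_univ _) h1)
    have h3 := Finset.mem_univ i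
    rw [← h2] at h3
    simpa using h3
  · intro y hy
    rw [(realLaplacian_isHermitian G Δ y).roots_charpoly_eq_eigenvalues]
    refine (Multiset.nodup_map_iff_of_injective ?_).2 Finset.univ.nodup
    intro i j hij
    replace hij : (realLaplacian_isHermitian G Δ y).eigenvalues i =
      (realLaplacian_isHermitian G Δ y).eigenvalues j := by simpa using hij
    by_cases h0 : (realLaplacian_isHermitian G Δ y).eigenvalues j = 0
    · exact Finset.card_le_one.1
        (eigenvalues_zero_dichotomy hG hpos hc0 hc (by linarith : 1 ≤ y)).1.le i
        (by simp [hij, h0]) j (by simp [h0])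
    · obtain ⟨e, -, -, -, h⟩ :=
        eigenvalues_bands hG hpos hΔ hc0 hc hC (by linarith) (hcy y hy) j h0
      exact h i hij
  · intro y hy μ hμ
    obtain ⟨i, rfl⟩ := mem_roots_charpoly_realLaplacian.1 hμ
    by_cases h0 : (realLaplacian_isHermitian G Δ y).eigenvalues i = 0
    · exact Or.inl h0
    obtain ⟨e, he, h1, h2, -⟩ :=
      eigenvalues_bands hG hpos hΔ hc0 hc hC (by linarith) (hcy y hy) i h0
    have hyp : (0 : ℝ) ≤ y ^ Δ e := pow_nonneg (by linarith) _
    refine Or.inr ⟨e, he, ?_, h2.trans (mul_le_mul_of_nonneg_right hDC hyp)⟩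
    have h3 := realLaplacian_eigenvalues_nonneg G Δ (by linarith : 0 ≤ y) i
    have h4 := mul_le_mul_of_nonneg_right hDc1 h3
    have h5 : y ^ Δ e ≤ 1 / c * (realLaplacian_isHermitian G Δ y).eigenvalues i := by
      rw [one_div, ← div_eq_inv_mul, le_div_iff₀ hc0, mul_comm]; exact h1
    linarith

end Separation

/-! ### From the union of spectra to the spectral polynomial -/

section Recovery

open scoped Classical
open Matrix

variable {V V' : Type*} [Fintype V] [Fintype V']

/-- The union of the spectra of the Laplacians `L(q ^ k)`, `k ∈ ℤ`. -/
def powerSpectrum (G : SimpleGraph V) (Δ : Sym2 V → ℕ) (q : ℝ) : Set ℝ :=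
  {μ | ∃ k : ℤ, μ ∈ (realLaplacian G Δ (q ^ k)).charpoly.roots}

theorem zero_mem_roots_realLaplacian [Nonempty V] (G : SimpleGraph V) (Δ : Sym2 V → ℕ) (y : ℝ) :
    0 ∈ (realLaplacian G Δ y).charpoly.roots := by
  rw [mem_roots (charpoly_monic _).ne_zero, charpoly_isRoot_iff]
  refine ⟨fun _ => 1, fun h => one_ne_zero (congrFun h (Classical.arbitrary V)), ?_⟩
  rw [zero_smul]
  exact edgeLaplacian_mulVec_eq_zero fun a b _ => Or.inr rfl

/-- The right-hand side refers to the graph only through the union of all spectra. The content is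
that an eigenvalue of some `L(q ^ k)` whose size is about `(q ^ r) ^ a`, with `r = 1 + m * ∏ a`,
must come from `k = r`. -/
theorem mem_roots_iff_mem_powerSpectrum [Nonempty V] {G : SimpleGraph V} {Δ : Sym2 V → ℕ}
    {D q : ℝ} (hD : SpectralSeparation G Δ D) (hq : D * D < q) {A : Finset ℕ}
    (hpos : ∀ a ∈ A, 0 < a) (hA : ∀ a ∈ A, ∀ b ∈ A, a ∣ b → a = b)
    (hΔ : ∀ e ∈ G.edgeSet, Δ e ∈ A) (m : ℕ) (μ : ℝ) :
    μ ∈ (realLaplacian G Δ (q ^ (1 + m * ∏ a ∈ A, a))).charpoly.roots ↔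
      μ = 0 ∨ (μ ∈ powerSpectrum G Δ q ∧ ∃ a ∈ A,
        (q ^ (1 + m * ∏ a ∈ A, a)) ^ a ≤ D * μ ∧ μ ≤ D * (q ^ (1 + m * ∏ a ∈ A, a)) ^ a) := by
  have hD1 := hD.one_le
  have hDq : D ≤ q := by nlinarith
  have hq1 : 1 < q := by nlinarith
  have hq0 : 0 < q := by linarith
  constructor
  · intro h
    refine (hD.comparable _ (hDq.trans (le_self_pow₀ hq1.le (by omega))) μ h).imp_right ?_
    rintro ⟨e, he, h1, h2⟩
    exact ⟨⟨_, by rw [zpow_natCast]; exact h⟩, Δ e, hΔ e he, h1, h2⟩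
  · rintro (rfl | ⟨⟨k, hk⟩, a, ha, h1, h2⟩)
    · exact zero_mem_roots_realLaplacian G Δ _
    set r := 1 + m * ∏ a ∈ A, a with hr
    rw [← pow_mul] at h1 h2
    have hra : r * a ≠ 0 := mul_ne_zero (by omega) (hpos a ha).ne'
    -- For `k ≤ 0` the eigenvalue is at most `D`, so `q ^ (r * a) ≤ D * D < q`, which is impossible.
    rcases le_or_gt k 0 with hk0 | hk0
    · have h3 := hD.le_of_le_one _ (zpow_pos hq0 k) (zpow_le_one_of_nonpos₀ hq1.le hk0) μ hk
      have h4 := le_self_pow₀ hq1.le hra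
      nlinarith
    lift k to ℕ using hk0.le
    rw [zpow_natCast] at hk
    have hk1 : k ≠ 0 := by omega
    rcases hD.comparable _ (hDq.trans (le_self_pow₀ hq1.le hk1)) μ hk with rfl | ⟨e, he, h3, h4⟩
    · rw [mul_zero] at h1
      exact absurd h1 (not_le.2 (by positivity))
    rw [← pow_mul] at h3 h4
    -- The total uncertainty `D * D` is less than one factor `q`, so the size of `μ` determines the
    -- exponent.
    have key : ∀ i j : ℕ, q ^ i ≤ D * μ → μ ≤ D * q ^ j → i ≤ j := by
      intro i j hi hj
      have hqj : 0 < q ^ j := by positivity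
      refine Nat.lt_succ_iff.1 ((pow_lt_pow_iff_right₀ hq1).1 ?_)
      calc q ^ i ≤ D * (D * q ^ j) := hi.trans (mul_le_mul_of_nonneg_left hj (by linarith))
        _ = (D * D) * q ^ j := by ring
        _ < q * q ^ j := mul_lt_mul_of_pos_right hq hqj
        _ = q ^ (j + 1) := by rw [pow_succ']
    have h5 : k * Δ e = r * a := le_antisymm (key _ _ h3 h2) (key _ _ h1 h4)
    -- Here `k * Δ e = a + m * (∏ a) * a`, and `Δ e` is one of the factors of the product.
    have h6 : Δ e ∣ a := by
      have h7 : Δ e ∣ m * (∏ a ∈ A, a) * a :=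
        ((Finset.dvd_prod_of_mem (fun a => a) (hΔ e he)).mul_left m).mul_right a
      have h8 : Δ e ∣ a + m * (∏ a ∈ A, a) * a := by
        refine ⟨k, ?_⟩
        rw [mul_comm (Δ e), h5, hr]; ring
      exact (Nat.dvd_add_left h7).1 h8
    have h9 := hA _ (hΔ e he) a ha h6
    rw [h9] at h5
    rwa [← Nat.eq_of_mul_eq_mul_right (hpos a ha) h5]

theorem charpoly_realLaplacian_eq_prod (G : SimpleGraph V) (Δ : Sym2 V → ℕ) (y : ℝ) :
    (realLaplacian G Δ y).charpoly =
      ((realLaplacian G Δ y).charpoly.roots.map fun μ => X - C μ).prod := by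
  rw [(realLaplacian_isHermitian G Δ y).roots_charpoly_eq_eigenvalues,
    (realLaplacian_isHermitian G Δ y).charpoly_eq]
  simp

theorem spectralPolynomial_map (G : SimpleGraph V) (Δ : Sym2 V → ℕ) (y : ℝ) :
    (spectralPolynomial G Δ).map (aeval y : ℤ[X] →ₐ[ℤ] ℝ).toRingHom =
      (realLaplacian G Δ y).charpoly := by
  rw [spectralPolynomial, weightedLaplacian_eq, ← charpoly_map, edgeLaplacian_map, realLaplacian]
  simp

/-- Each coefficient of a power of `X` is a polynomial in `Y`, determined by its values at
infinitely many reals. -/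
theorem spectralPolynomial_eq_of_infinite {G : SimpleGraph V} {Δ : Sym2 V → ℕ}
    {G' : SimpleGraph V'} {Δ' : Sym2 V' → ℕ} {s : Set ℝ} (hs : s.Infinite)
    (h : ∀ y ∈ s, (realLaplacian G Δ y).charpoly = (realLaplacian G' Δ' y).charpoly) :
    spectralPolynomial G Δ = spectralPolynomial G' Δ' := by
  ext1 j
  refine Polynomial.map_injective _ (RingHom.injective_int (Int.castRingHom ℝ))
    (Polynomial.eq_of_infinite_eval_eq _ _ (hs.mono fun y hy => ?_))
  have h1 := congrArg (fun p => p.coeff j) (h y hy)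
  rw [← spectralPolynomial_map, ← spectralPolynomial_map] at h1
  simp only [coeff_map] at h1
  simpa [aeval_def, eval_map] using! h1

/-- The spectral polynomial is recovered from the union of the spectra of the `L(q ^ k)`. -/
theorem spectralPolynomial_eq_of_powerSpectrum_eq [Nonempty V] [Nonempty V']
    {G : SimpleGraph V} {Δ : Sym2 V → ℕ} {G' : SimpleGraph V'} {Δ' : Sym2 V' → ℕ}
    {D q : ℝ} (hD : SpectralSeparation G Δ D) (hD' : SpectralSeparation G' Δ' D)
    (hq : D * D < q) {A : Finset ℕ}
    (hpos : ∀ a ∈ A, 0 < a) (hA : ∀ a ∈ A, ∀ b ∈ A, a ∣ b → a = b)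
    (hΔ : ∀ e ∈ G.edgeSet, Δ e ∈ A) (hΔ' : ∀ e ∈ G'.edgeSet, Δ' e ∈ A)
    (h : powerSpectrum G Δ q = powerSpectrum G' Δ' q) :
    spectralPolynomial G Δ = spectralPolynomial G' Δ' := by
  have hD1 := hD.one_le
  have hDq : D ≤ q := by nlinarith
  have hq1 : 1 < q := by nlinarith
  refine spectralPolynomial_eq_of_infinite
    (s := Set.range fun m : ℕ => q ^ (1 + m * ∏ a ∈ A, a)) ?_ ?_
  · refine Set.infinite_range_of_injective fun m n hmn => ?_
    have h1 := pow_right_injective₀ (by linarith) hq1.ne' hmn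
    exact Nat.eq_of_mul_eq_mul_right (Finset.prod_pos hpos) (Nat.add_left_cancel h1)
  · rintro _ ⟨m, rfl⟩
    have hy : D ≤ q ^ (1 + m * ∏ a ∈ A, a) := hDq.trans (le_self_pow₀ hq1.le (by omega))
    simp only
    -- Since the roots are simple, the set of roots determines their multiset and thereby the
    -- polynomial.
    rw [charpoly_realLaplacian_eq_prod, charpoly_realLaplacian_eq_prod G',
      (Multiset.Nodup.ext (hD.nodup _ hy) (hD'.nodup _ hy)).2 fun μ => ?_]
    rw [mem_roots_iff_mem_powerSpectrum hD hq hpos hA hΔ,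
      mem_roots_iff_mem_powerSpectrum hD' hq hpos hA hΔ', h]

end Recovery

/-! ### Test functions and uniqueness on ultrametric balls -/

section Fourier

set_option linter.unusedSectionVars false

variable {K : Type*} [NontriviallyNormedField K] [IsUltrametricDist K] [ProperSpace K]
  [MeasurableSpace K] [BorelSpace K]

instance haarK_isAddHaarMeasure : (haarK K).IsAddHaarMeasure := by
  unfold haarK; infer_instance

section Indicators

theorem continuous_indicator_closedBall {φ : K → ℂ} (hφ : Continuous φ) (b : K) {r : ℝ}
    (hr : r ≠ 0) : Continuous ((Metric.closedBall b r).indicator φ) :=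
  hφ.indicator fun a ha => by
    rw [(IsUltrametricDist.isClopen_closedBall b hr).frontier_eq] at ha
    exact ha.elim

theorem hasCompactSupport_indicator_closedBall (φ : K → ℂ) (b : K) (r : ℝ) :
    HasCompactSupport ((Metric.closedBall b r).indicator φ) :=
  HasCompactSupport.intro (isCompact_closedBall b r) fun _ hx => Set.indicator_of_notMem hx _

theorem memLp_indicator_closedBall {φ : K → ℂ} (hφ : Continuous φ) (b : K) {r : ℝ}
    (hr : r ≠ 0) (p : ℝ≥0∞) : MemLp ((Metric.closedBall b r).indicator φ) p (haarK K) :=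
  (continuous_indicator_closedBall hφ b hr).memLp_of_hasCompactSupport
    (hasCompactSupport_indicator_closedBall φ b r)

theorem haarK_real_closedBall_pos (b : K) {r : ℝ} (hr : 0 < r) :
    0 < (haarK K).real (Metric.closedBall b r) :=
  ENNReal.toReal_pos (Metric.measure_closedBall_pos _ b hr).ne'
    (isCompact_closedBall b r).measure_lt_top.ne

variable (K) in
/-- The balls of positive radius in the value group. -/
def valueBalls : Set (Set K) := {s | ∃ b c : K, c ≠ 0 ∧ s = Metric.closedBall b ‖c‖}

theorem isTopologicalBasis_valueBalls : TopologicalSpace.IsTopologicalBasis (valueBalls K) := by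
  refine TopologicalSpace.isTopologicalBasis_of_isOpen_of_nhds ?_ ?_
  · rintro _ ⟨b, c, hc, rfl⟩
    exact IsUltrametricDist.isOpen_closedBall b (norm_ne_zero_iff.2 hc)
  · intro a u ha hu
    obtain ⟨ε, hε, hball⟩ := Metric.isOpen_iff.1 hu a ha
    obtain ⟨c, hc0, hcε⟩ := NormedField.exists_norm_lt K hε
    exact ⟨_, ⟨a, c, norm_pos_iff.1 hc0, rfl⟩, Metric.mem_closedBall_self hc0.le,
      (Metric.closedBall_subset_ball hcε).trans hball⟩

/-- Ultrametric balls are nested or disjoint. So the balls form a π-system generating the Borel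
sets. -/
theorem inter_mem_valueBalls {s t : Set K} (hs : s ∈ valueBalls K) (ht : t ∈ valueBalls K) :
    s ∩ t = ∅ ∨ s ∩ t ∈ valueBalls K := by
  have hs' := hs
  have ht' := ht
  obtain ⟨b, c, -, rfl⟩ := hs'
  obtain ⟨b', c', -, rfl⟩ := ht'
  rcases IsUltrametricDist.closedBall_subset_trichotomy (x := b) (y := b') (r := ‖c‖)
    (s := ‖c'‖) with h | h | h
  · exact Or.inr (by rwa [Set.inter_eq_left.2 h])
  · exact Or.inr (by rwa [Set.inter_eq_right.2 h])
  · exact Or.inl h.inter_eq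

/-- A square integrable function whose integrals over all balls vanish is zero. -/
theorem eq_zero_of_forall_integral_closedBall_eq_zero {h : K → ℂ} (hh : MemLp h 2 (haarK K))
    (h0 : ∀ b c : K, c ≠ 0 → ∫ x in Metric.closedBall b ‖c‖, h x ∂(haarK K) = 0) :
    h =ᵐ[haarK K] 0 := by
  have h0' : ∀ s ∈ valueBalls K, ∫ x in s, h x ∂(haarK K) = 0 := by
    rintro _ ⟨b, c, hc, rfl⟩
    exact h0 b c hc
  have hgen : ‹MeasurableSpace K› = MeasurableSpace.generateFrom (valueBalls K) :=
    (BorelSpace.measurable_eq (α := K)).trans isTopologicalBasis_valueBalls.borel_eq_generateFrom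
  have hpi : IsPiSystem (valueBalls K) := fun s hs t ht hst =>
    (inter_mem_valueBalls hs ht).resolve_left hst.ne_empty
  -- On a ball, of finite measure, a square integrable function is integrable, and the π-λ theorem
  -- applies. Countably many balls cover `K`.
  have hloc : ∀ B ∈ valueBalls K, h =ᵐ[(haarK K).restrict B] 0 := by
    intro B hB
    have hBfin : IsFiniteMeasure ((haarK K).restrict B) := by
      obtain ⟨b, c, -, rfl⟩ := hB
      exact ⟨by simpa using (isCompact_closedBall b ‖c‖).measure_lt_top⟩
    have hint : Integrable h ((haarK K).restrict B) :=
      (hh.restrict _).integrable (by norm_num)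
    have hmeas : ∀ t ∈ valueBalls K, MeasurableSet t := fun t ht =>
      (isTopologicalBasis_valueBalls.isOpen ht).measurableSet
    refine hint.ae_eq_zero_of_forall_setIntegral_eq_zero fun s hs _ => ?_
    induction s, hs using MeasurableSpace.induction_on_inter hgen hpi with
    | empty => simp
    | basic t ht =>
      rw [Measure.restrict_restrict (hmeas t ht)]
      rcases inter_mem_valueBalls ht hB with h1 | h1
      · simp [h1]
      · exact h0' _ h1
    | compl t htm ih =>
      rw [setIntegral_compl htm hint, ih (measure_lt_top _ _), h0' B hB, sub_zero]
    | iUnion f hd hm ih =>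
      rw [integral_iUnion hm hd hint.integrableOn]
      simp [ih]
  have hcover : ∀ n : ℕ, ∃ c : K, (n : ℝ) < ‖c‖ := fun n => NormedField.exists_lt_norm K n
  choose c hc using hcover
  have hun : ⋃ n, Metric.closedBall (0 : K) ‖c n‖ = Set.univ := by
    refine Set.eq_univ_of_forall fun x => ?_
    obtain ⟨n, hn⟩ := exists_nat_gt ‖x‖
    exact Set.mem_iUnion.2 ⟨n, by rw [mem_closedBall_zero_iff]; exact (hn.trans (hc n)).le⟩
  rw [← Measure.restrict_univ (μ := haarK K), ← hun, Filter.EventuallyEq, ae_restrict_iUnion_iff]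
  refine fun n => hloc _ ⟨0, c n, ?_, rfl⟩
  exact norm_pos_iff.1 ((Nat.cast_nonneg n).trans_lt (hc n))

end Indicators

/-! ### Duality for the Fourier graph -/

section Duality

variable {χ : AddChar K Circle}

theorem integral_fourierIntegral_mul (hχ : Continuous χ) {f g : K → ℂ}
    (hf : Integrable f (haarK K)) (hg : Integrable g (haarK K)) :
    ∫ ξ, fourierIntegral χ f ξ * g ξ ∂(haarK K) = ∫ x, f x * fourierIntegral χ g x ∂(haarK K) := by
  -- The general Fourier integral has the kernel `e (-L v w)`, so `e = χ⁻¹` gives `χ (ξ * x)`.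
  have h := VectorFourier.integral_fourierIntegral_smul_eq_flip (e := χ⁻¹) (μ := haarK K)
    (ν := haarK K) (L := LinearMap.mul K K) (f := f) (g := g)
    (hχ.comp continuous_neg) (by exact continuous_mul) hf hg
  simp only [VectorFourier.fourierIntegral, Circle.smul_def, LinearMap.flip_apply,
    LinearMap.mul_apply', AddChar.inv_apply, neg_neg, smul_eq_mul] at h
  simp only [fourierIntegral]
  simp only [mul_comm _ (_ : K)] at h ⊢
  exact h

/-- The duality `∫ ℱf · g = ∫ f · ℱg` extends to the graph of the Fourier transform. -/
theorem integral_mul_eq_of_mem_fourierGraph (hχ : Continuous χ) {f F : L2 K}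
    (hfF : (f, F) ∈ fourierGraph χ) {g : K → ℂ} (hg : MemLp g 2 (haarK K))
    (hg1 : Integrable g (haarK K)) (hg' : MemLp (fourierIntegral χ g) 2 (haarK K)) :
    ∫ ξ, F ξ * g ξ ∂(haarK K) = ∫ x, f x * fourierIntegral χ g x ∂(haarK K) := by
  have key : ∀ {k : K → ℂ} (hk : MemLp k 2 (haarK K)) (u : L2 K),
      innerSL ℂ (hk.star.toLp (star k)) u = ∫ x, u x * k x ∂(haarK K) := by
    intro k hk u
    rw [innerSL_apply_apply, L2.inner_def]
    refine integral_congr_ae ?_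
    filter_upwards [hk.star.coeFn_toLp] with x hx
    simp [hx]
  -- The difference of the two sides is a continuous functional of `(f, F)` that vanishes on the
  -- generators, hence on their closed span. The stars undo the conjugation in the inner product.
  let T : L2 K × L2 K →L[ℂ] ℂ :=
    (innerSL ℂ (hg.star.toLp (star g))) ∘L ContinuousLinearMap.snd ℂ (L2 K) (L2 K) -
    (innerSL ℂ (hg'.star.toLp (star (fourierIntegral χ g)))) ∘L
      ContinuousLinearMap.fst ℂ (L2 K) (L2 K)
  have hT : ∀ x : L2 K × L2 K, T x = (∫ ξ, x.2 ξ * g ξ ∂(haarK K)) -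
      ∫ ξ, x.1 ξ * fourierIntegral χ g ξ ∂(haarK K) := by
    intro x
    rw [← key hg, ← key hg']
    rfl
  have hle : fourierGraph χ ≤ T.ker := by
    refine Submodule.topologicalClosure_minimal _ (Submodule.span_le.2 ?_) T.isClosed_ker
    rintro x ⟨h1, h2⟩
    rw [SetLike.mem_coe, LinearMap.mem_ker]
    refine (hT x).trans ?_
    rw [sub_eq_zero, ← integral_fourierIntegral_mul hχ h1 hg1]
    refine integral_congr_ae ?_
    filter_upwards [h2] with ξ hξ
    rw [hξ]
  have h := hT (f, F)
  rw [show T (f, F) = 0 from hle hfF] at h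
  exact (sub_eq_zero.1 h.symm)

end Duality

/-! ### The conductor of the character -/

section Conductor

variable {χ : AddChar K Circle}

/-- The circle has no small subgroups. If `|χ - 1|` is at most `1/2` on a ball and maximal there at
`m`, then `m + m` is also in the ball and `|χ (m + m) - 1| = |χ m - 1| |χ m + 1| ≥ (3/2) |χ m - 1|`,
so the maximum is zero. -/
theorem exists_ne_zero_forall_eq_one (hχ : Continuous χ) :
    ∃ c : K, c ≠ 0 ∧ ∀ x : K, ‖x‖ ≤ ‖c‖ → χ x = 1 := by
  have hcont : Continuous fun x : K => ‖(χ x : ℂ) - 1‖ := by fun_prop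
  have hnear : ∀ᶠ x in nhds (0 : K), ‖(χ x : ℂ) - 1‖ < 1 / 2 := by
    refine hcont.continuousAt.eventually_lt continuousAt_const ?_
    simp
  obtain ⟨ε, hε, hball⟩ := Metric.eventually_nhds_iff.1 hnear
  obtain ⟨c, hc0, hcε⟩ := NormedField.exists_norm_lt K hε
  have hc : c ≠ 0 := norm_pos_iff.1 hc0
  refine ⟨c, hc, fun x hx => ?_⟩
  obtain ⟨m, hm, hmax⟩ := (isCompact_closedBall (0 : K) ‖c‖).exists_isMaxOn
    ⟨0, by simp⟩ hcont.continuousOn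
  rw [mem_closedBall_zero_iff] at hm
  have h1 : ‖m + m‖ ≤ ‖c‖ :=
    (IsUltrametricDist.norm_add_le_max m m).trans (by simpa using hm)
  have h2 : ‖(χ (m + m) : ℂ) - 1‖ ≤ ‖(χ m : ℂ) - 1‖ := hmax (by simpa using h1)
  have h3 : ‖(χ m : ℂ) - 1‖ < 1 / 2 := hball (by rw [dist_zero_right]; linarith)
  have h4 : (χ (m + m) : ℂ) - 1 = ((χ m : ℂ) - 1) * (2 + ((χ m : ℂ) - 1)) := by
    rw [AddChar.map_add_eq_mul, Circle.coe_mul]; ring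
  have h5 : (3 / 2 : ℝ) ≤ ‖2 + ((χ m : ℂ) - 1)‖ := by
    have := norm_sub_le_norm_add (2 : ℂ) ((χ m : ℂ) - 1)
    rw [Complex.norm_ofNat] at this
    linarith
  rw [h4, norm_mul] at h2
  have h6 : ‖(χ m : ℂ) - 1‖ ≤ 0 := by
    nlinarith [norm_nonneg ((χ m : ℂ) - 1)]
  have h7 : ‖(χ x : ℂ) - 1‖ ≤ 0 := le_trans (hmax (by simpa using hx)) h6
  rw [norm_le_zero_iff, sub_eq_zero] at h7
  exact Circle.ext (by simpa using h7)

/-- The conductor of a non-trivial continuous character. -/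
theorem exists_conductor (hχ : Continuous χ) (hχ1 : ∃ x, χ x ≠ 1) :
    ∃ δ : K, δ ≠ 0 ∧ ∀ ξ : K, (∀ x : K, ‖x‖ ≤ 1 → χ (ξ * x) = 1) ↔ ‖ξ‖ ≤ ‖δ‖ := by
  obtain ⟨x₀, hx₀⟩ := hχ1
  have hx₀' : x₀ ≠ 0 := fun h => hx₀ (by simp [h])
  obtain ⟨c, hc, hc1⟩ := exists_ne_zero_forall_eq_one hχ
  set S : Set K := {ξ | ∀ x : K, ‖x‖ ≤ 1 → χ (ξ * x) = 1} with hS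
  have hSclosed : IsClosed S := by
    simp only [hS, Set.ofPred_forall]
    refine isClosed_iInter fun x => isClosed_iInter fun _ => ?_
    exact isClosed_eq (by fun_prop) continuous_const
  -- If `ξ` were larger than `x₀`, then `x₀` would be `ξ` times an integral element, and `χ x₀ = 1`.
  have hSsub : S ⊆ Metric.closedBall 0 ‖x₀‖ := by
    intro ξ hξ
    rw [mem_closedBall_zero_iff]
    by_contra! hlt
    have hξ0 : ξ ≠ 0 := by rintro rfl; simp at hlt; linarith [norm_nonneg x₀]
    refine hx₀ ?_
    have := hξ (x₀ / ξ) (by rw [norm_div, div_le_one (norm_pos_iff.2 hξ0)]; exact hlt.le)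
    rwa [mul_div_cancel₀ _ hξ0] at this
  have hScomp : IsCompact S := (isCompact_closedBall 0 ‖x₀‖).of_isClosed_subset hSclosed hSsub
  have hcS : c ∈ S := fun x hx => hc1 _ (by
    rw [norm_mul]; exact mul_le_of_le_one_right (norm_nonneg c) hx)
  obtain ⟨δ, hδ, hmax⟩ := hScomp.exists_isMaxOn ⟨c, hcS⟩ continuous_norm.continuousOn
  have hδ0 : δ ≠ 0 := norm_pos_iff.1 ((norm_pos_iff.2 hc).trans_le (hmax hcS))
  -- `S` is stable under multiplication by integers of `K`, so it contains everything no larger than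
  -- its largest element `δ`.
  refine ⟨δ, hδ0, fun ξ => ⟨fun h => hmax h, fun h x hx => ?_⟩⟩
  have := hδ (ξ / δ * x) (by
    rw [norm_mul, norm_div]
    exact mul_le_one₀ ((div_le_one (norm_pos_iff.2 hδ0)).2 h) (norm_nonneg x) hx)
  rwa [← mul_assoc, mul_div_cancel₀ _ hδ0] at this

end Conductor

end Fourier

/-! ### Fourier transforms of balls and spheres; injectivity of the transform -/

section FourierBalls

set_option linter.unusedSectionVars false

variable {K : Type*} [NontriviallyNormedField K] [IsUltrametricDist K] [ProperSpace K]
  [MeasurableSpace K] [BorelSpace K] {χ : AddChar K Circle} {δ : K}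

theorem mul_indicator_closedBall_add (φ : K → ℂ) (b x x₀ : K) {r : ℝ} (hx₀ : ‖x₀‖ ≤ r) :
    (Metric.closedBall b r).indicator φ (x + x₀) =
      (Metric.closedBall b r).indicator (fun y => φ (y + x₀)) x := by
  have h : x + x₀ ∈ Metric.closedBall b r ↔ x ∈ Metric.closedBall b r := by
    have h1 : x ∈ Metric.closedBall (x + x₀) r := by
      rw [mem_closedBall_iff_norm']; simpa using hx₀
    constructor
    · intro h2
      rwa [IsUltrametricDist.closedBall_eq_of_mem h2]
    · intro h2
      have h3 := IsUltrametricDist.closedBall_eq_of_mem h1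
      have h4 := IsUltrametricDist.closedBall_eq_of_mem h2
      rw [h4, ← h3]
      exact Metric.mem_closedBall_self ((norm_nonneg _).trans hx₀)
  by_cases hx : x ∈ Metric.closedBall b r
  · rw [Set.indicator_of_mem hx, Set.indicator_of_mem (h.2 hx)]
  · rw [Set.indicator_of_notMem hx, Set.indicator_of_notMem fun h' => hx (h.1 h')]

/-- The Fourier transform of the indicator function of a ball around `0`. -/
theorem fourierIntegral_closedBall
    (hδ : ∀ ξ : K, (∀ x : K, ‖x‖ ≤ 1 → χ (ξ * x) = 1) ↔ ‖ξ‖ ≤ ‖δ‖) {c : K} (hc : c ≠ 0) (ξ : K) :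
    fourierIntegral χ ((Metric.closedBall 0 ‖c‖).indicator 1) ξ =
      (Metric.closedBall 0 ‖δ / c‖).indicator
        (fun _ => ((haarK K).real (Metric.closedBall 0 ‖c‖) : ℂ)) ξ := by
  have hiff : ξ ∈ Metric.closedBall (0 : K) ‖δ / c‖ ↔ ‖ξ * c‖ ≤ ‖δ‖ := by
    rw [mem_closedBall_zero_iff, norm_div, norm_mul, le_div_iff₀ (norm_pos_iff.2 hc)]
  by_cases hξ : ‖ξ * c‖ ≤ ‖δ‖
  · rw [Set.indicator_of_mem (hiff.2 hξ), fourierIntegral]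
    have h1 : ∀ x, (χ (ξ * x) : ℂ) * (Metric.closedBall (0 : K) ‖c‖).indicator 1 x =
        (Metric.closedBall (0 : K) ‖c‖).indicator (fun _ => (1 : ℂ)) x := by
      intro x
      by_cases hx : x ∈ Metric.closedBall (0 : K) ‖c‖
      · rw [Set.indicator_of_mem hx, Set.indicator_of_mem hx, Pi.one_apply, mul_one]
        rw [mem_closedBall_zero_iff] at hx
        have h2 := (hδ _).2 hξ (x / c) (by
          rw [norm_div]; exact (div_le_one (norm_pos_iff.2 hc)).2 hx)
        rw [mul_assoc, mul_div_cancel₀ _ hc] at h2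
        rw [h2, Circle.coe_one]
      · rw [Set.indicator_of_notMem hx, Set.indicator_of_notMem hx, mul_zero]
    simp_rw [h1]
    rw [integral_indicator Metric.isClosed_closedBall.measurableSet]
    simp
  · rw [Set.indicator_of_notMem fun h => hξ (hiff.1 h)]
    rw [← hδ] at hξ
    push Not at hξ
    obtain ⟨x₁, hx₁, hne⟩ := hξ
    have hx₀ : ‖c * x₁‖ ≤ ‖c‖ := by
      rw [norm_mul]; exact mul_le_of_le_one_right (norm_nonneg _) hx₁
    -- Translation by `c * x₁` preserves the ball but multiplies the integral by a number different
    -- from `1`, so the integral is zero.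
    have h1 : fourierIntegral χ ((Metric.closedBall 0 ‖c‖).indicator 1) ξ =
        (χ (ξ * (c * x₁)) : ℂ) * fourierIntegral χ ((Metric.closedBall 0 ‖c‖).indicator 1) ξ := by
      conv_lhs => rw [fourierIntegral, ← integral_add_right_eq_self _ (c * x₁)]
      rw [fourierIntegral, ← integral_const_mul]
      refine integral_congr_ae (Filter.Eventually.of_forall fun x => ?_)
      simp only [mul_indicator_closedBall_add _ _ _ _ hx₀, mul_add, AddChar.map_add_eq_mul,
        Circle.coe_mul, Pi.one_apply]
      simp only [Pi.one_def]
      ring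
    have h2 : ((χ (ξ * (c * x₁)) : ℂ) - 1) *
        fourierIntegral χ ((Metric.closedBall 0 ‖c‖).indicator 1) ξ = 0 := by
      linear_combination -h1
    refine (mul_eq_zero.1 h2).resolve_left fun h => hne ?_
    rw [sub_eq_zero] at h
    rw [mul_assoc]
    exact Circle.ext (by simpa using h)

theorem fourierIntegral_closedBall_translate {b : K} {r : ℝ} (ξ : K) :
    fourierIntegral χ ((Metric.closedBall b r).indicator 1) ξ =
      (χ (ξ * b) : ℂ) * fourierIntegral χ ((Metric.closedBall 0 r).indicator 1) ξ := by
  conv_lhs => rw [fourierIntegral, ← integral_add_right_eq_self _ b]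
  rw [fourierIntegral, ← integral_const_mul]
  refine integral_congr_ae (Filter.Eventually.of_forall fun x => ?_)
  have h : (Metric.closedBall b r).indicator (1 : K → ℂ) (x + b) =
      (Metric.closedBall 0 r).indicator (1 : K → ℂ) x := by
    have : x + b ∈ Metric.closedBall b r ↔ x ∈ Metric.closedBall 0 r := by
      simp
    by_cases hx : x ∈ Metric.closedBall 0 r
    · rw [Set.indicator_of_mem hx, Set.indicator_of_mem (this.2 hx), Pi.one_apply, Pi.one_apply]
    · rw [Set.indicator_of_notMem hx, Set.indicator_of_notMem fun h' => hx (this.1 h')]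
  simp only [h, mul_add, AddChar.map_add_eq_mul, Circle.coe_mul]
  ring

theorem fourierIntegral_closedBall_modulate {b : K} {r : ℝ} (ξ : K) :
    fourierIntegral χ ((Metric.closedBall 0 r).indicator fun x => (χ (-b * x) : ℂ)) ξ =
      fourierIntegral χ ((Metric.closedBall 0 r).indicator 1) (ξ - b) := by
  refine integral_congr_ae (Filter.Eventually.of_forall fun x => ?_)
  by_cases hx : x ∈ Metric.closedBall 0 r
  · simp only [Set.indicator_of_mem hx, Pi.one_apply, mul_one]
    rw [sub_eq_add_neg, add_mul, AddChar.map_add_eq_mul, Circle.coe_mul]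
  · simp only [Set.indicator_of_notMem hx, mul_zero]

theorem integral_mul_indicator_one (h : K → ℂ) (b : K) (r : ℝ) (z : ℂ) :
    ∫ x, h x * (Metric.closedBall b r).indicator (fun _ => z) x ∂(haarK K) =
      (∫ x in Metric.closedBall b r, h x ∂(haarK K)) * z := by
  rw [← integral_indicator Metric.isClosed_closedBall.measurableSet, ← integral_mul_const]
  refine integral_congr_ae (Filter.Eventually.of_forall fun x => ?_)
  by_cases hx : x ∈ Metric.closedBall b r
  · simp only [Set.indicator_of_mem hx]
  · simp only [Set.indicator_of_notMem hx, mul_zero, zero_mul]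

/-- Duality against the indicator of a ball shows that the integral of `F` over that ball is zero.
Thus the transform is single-valued, and Plancherel's theorem is not required. -/
theorem fourierGraph_left_zero (hχ : Continuous χ)
    (hδ : ∀ ξ : K, (∀ x : K, ‖x‖ ≤ 1 → χ (ξ * x) = 1) ↔ ‖ξ‖ ≤ ‖δ‖) (hδ0 : δ ≠ 0)
    {F : L2 K} (h : (0, F) ∈ fourierGraph χ) : F = 0 := by
  rw [Lp.eq_zero_iff_ae_eq_zero]
  refine eq_zero_of_forall_integral_closedBall_eq_zero (Lp.memLp F) fun b c hc => ?_
  have hc' : ‖c‖ ≠ 0 := norm_ne_zero_iff.2 hc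
  have hmem : ∀ p, MemLp ((Metric.closedBall b ‖c‖).indicator (1 : K → ℂ)) p (haarK K) :=
    fun p => memLp_indicator_closedBall continuous_one b hc' p
  have hft : fourierIntegral χ ((Metric.closedBall b ‖c‖).indicator 1) =
      (Metric.closedBall 0 ‖δ / c‖).indicator
        (fun ξ => (χ (ξ * b) : ℂ) * ((haarK K).real (Metric.closedBall 0 ‖c‖) : ℂ)) := by
    ext ξ
    rw [fourierIntegral_closedBall_translate, fourierIntegral_closedBall hδ hc,
      Set.indicator_mul_right _ (fun ξ => (χ (ξ * b) : ℂ))]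
  have hft2 : MemLp (fourierIntegral χ ((Metric.closedBall b ‖c‖).indicator 1)) 2 (haarK K) := by
    rw [hft]
    exact memLp_indicator_closedBall (by fun_prop) 0
      (norm_ne_zero_iff.2 (div_ne_zero hδ0 hc)) 2
  have key := integral_mul_eq_of_mem_fourierGraph hχ h (hmem 2) (memLp_one_iff_integrable.1 (hmem 1))
    hft2
  have h0 : ∫ x, (0 : L2 K) x * fourierIntegral χ ((Metric.closedBall b ‖c‖).indicator 1) x
      ∂(haarK K) = 0 := by
    rw [← integral_zero K ℂ (μ := haarK K)]
    refine integral_congr_ae ?_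
    filter_upwards [Lp.coeFn_zero ℂ 2 (haarK K)] with x hx
    rw [hx, Pi.zero_apply, zero_mul]
  rw [h0] at key
  simpa using (integral_mul_indicator_one F b ‖c‖ 1).symm.trans key

/-- Injectivity, again by duality: a modulated indicator of a ball around `0` has as its transform a
nonzero multiple of the indicator of an arbitrary ball. -/
theorem fourierGraph_right_zero (hχ : Continuous χ)
    (hδ : ∀ ξ : K, (∀ x : K, ‖x‖ ≤ 1 → χ (ξ * x) = 1) ↔ ‖ξ‖ ≤ ‖δ‖) (hδ0 : δ ≠ 0)
    {f : L2 K} (h : (f, 0) ∈ fourierGraph χ) : f = 0 := by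
  rw [Lp.eq_zero_iff_ae_eq_zero]
  refine eq_zero_of_forall_integral_closedBall_eq_zero (Lp.memLp f) fun b c hc => ?_
  have hd : δ / c ≠ 0 := div_ne_zero hδ0 hc
  have hd' : ‖δ / c‖ ≠ 0 := norm_ne_zero_iff.2 hd
  have hmem : ∀ p, MemLp ((Metric.closedBall 0 ‖δ / c‖).indicator fun x : K => (χ (-b * x) : ℂ))
      p (haarK K) :=
    fun p => memLp_indicator_closedBall (by fun_prop) 0 hd' p
  have hft : fourierIntegral χ ((Metric.closedBall 0 ‖δ / c‖).indicator
      fun x : K => (χ (-b * x) : ℂ)) = (Metric.closedBall b ‖c‖).indicator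
        (fun _ => ((haarK K).real (Metric.closedBall 0 ‖δ / c‖) : ℂ)) := by
    ext ξ
    rw [fourierIntegral_closedBall_modulate, fourierIntegral_closedBall hδ hd,
      div_div_cancel₀ hδ0]
    have : ξ - b ∈ Metric.closedBall (0 : K) ‖c‖ ↔ ξ ∈ Metric.closedBall b ‖c‖ := by
      rw [mem_closedBall_zero_iff, Metric.mem_closedBall, dist_eq_norm]
    by_cases hx : ξ ∈ Metric.closedBall b ‖c‖
    · rw [Set.indicator_of_mem hx, Set.indicator_of_mem (this.2 hx)]
    · rw [Set.indicator_of_notMem hx, Set.indicator_of_notMem fun h' => hx (this.1 h')]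
  have hft2 : MemLp (fourierIntegral χ ((Metric.closedBall 0 ‖δ / c‖).indicator
      fun x : K => (χ (-b * x) : ℂ))) 2 (haarK K) := by
    rw [hft]
    exact memLp_indicator_closedBall (by fun_prop) b (norm_ne_zero_iff.2 hc) 2
  have key := integral_mul_eq_of_mem_fourierGraph hχ h (hmem 2) (memLp_one_iff_integrable.1 (hmem 1))
    hft2
  have h0 : ∫ x, (0 : L2 K) x * ((Metric.closedBall 0 ‖δ / c‖).indicator
      fun x : K => (χ (-b * x) : ℂ)) x ∂(haarK K) = 0 := by
    rw [← integral_zero K ℂ (μ := haarK K)]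
    refine integral_congr_ae ?_
    filter_upwards [Lp.coeFn_zero ℂ 2 (haarK K)] with x hx
    rw [hx, Pi.zero_apply, zero_mul]
  rw [h0, hft, integral_mul_indicator_one] at key
  refine (mul_eq_zero.1 key.symm).resolve_right ?_
  exact_mod_cast (haarK_real_closedBall_pos (0 : K) (norm_pos_iff.2 hd)).ne'

theorem fourierGraph_unique (hχ : Continuous χ)
    (hδ : ∀ ξ : K, (∀ x : K, ‖x‖ ≤ 1 → χ (ξ * x) = 1) ↔ ‖ξ‖ ≤ ‖δ‖) (hδ0 : δ ≠ 0)
    {f F F' : L2 K} (h : (f, F) ∈ fourierGraph χ) (h' : (f, F') ∈ fourierGraph χ) : F = F' := by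
  have := (fourierGraph χ).sub_mem h h'
  rw [Prod.mk_sub_mk, sub_self] at this
  exact sub_eq_zero.1 (fourierGraph_left_zero hχ hδ hδ0 this)

/-- The indicator function of a ball around `0` is a Fourier transform. -/
theorem exists_mem_fourierGraph_closedBall
    (hδ : ∀ ξ : K, (∀ x : K, ‖x‖ ≤ 1 → χ (ξ * x) = 1) ↔ ‖ξ‖ ≤ ‖δ‖) (hδ0 : δ ≠ 0)
    {c : K} (hc : c ≠ 0) : ∃ f F : L2 K, (f, F) ∈ fourierGraph χ ∧
      F =ᵐ[haarK K] (Metric.closedBall 0 ‖c‖).indicator fun _ => (1 : ℂ) := by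
  have hd : δ / c ≠ 0 := div_ne_zero hδ0 hc
  have hmem : ∀ p, MemLp ((Metric.closedBall 0 ‖δ / c‖).indicator (1 : K → ℂ)) p (haarK K) :=
    fun p => memLp_indicator_closedBall continuous_one 0 (norm_ne_zero_iff.2 hd) p
  have hv0 : ((haarK K).real (Metric.closedBall 0 ‖δ / c‖) : ℂ) ≠ 0 := by
    exact_mod_cast (haarK_real_closedBall_pos (0 : K) (norm_pos_iff.2 hd)).ne'
  set v : ℂ := ((haarK K).real (Metric.closedBall 0 ‖δ / c‖) : ℂ)
  have hft : fourierIntegral χ ((Metric.closedBall 0 ‖δ / c‖).indicator 1) =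
      (Metric.closedBall 0 ‖c‖).indicator (fun _ => v) := by
    ext ξ
    rw [fourierIntegral_closedBall hδ hd, div_div_cancel₀ hδ0]
  have hft2 : MemLp ((Metric.closedBall 0 ‖c‖).indicator fun _ : K => v) 2 (haarK K) :=
    memLp_indicator_closedBall continuous_const 0 (norm_ne_zero_iff.2 hc) 2
  have hgr : ((hmem 2).toLp, hft2.toLp) ∈ fourierGraph χ := by
    refine Submodule.le_topologicalClosure _ (Submodule.subset_span ⟨?_, ?_⟩)
    · exact (memLp_one_iff_integrable.1 (hmem 1)).congr (hmem 2).coeFn_toLp.symm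
    · refine hft2.coeFn_toLp.trans (Filter.Eventually.of_forall fun ξ => ?_)
      refine (congrFun hft ξ).symm.trans (integral_congr_ae ?_)
      filter_upwards [(hmem 2).coeFn_toLp] with x hx
      simp only [hx]
  refine ⟨v⁻¹ • (hmem 2).toLp, v⁻¹ • hft2.toLp, (fourierGraph χ).smul_mem v⁻¹ hgr, ?_⟩
  filter_upwards [Lp.coeFn_smul v⁻¹ hft2.toLp, hft2.coeFn_toLp] with ξ h1 h2
  rw [h1, Pi.smul_apply, h2, smul_eq_mul, ← Set.indicator_const_mul]
  simp [hv0]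

/-- The indicator function of a sphere around `0` is a Fourier transform. -/
theorem exists_mem_fourierGraph_sphere
    (hδ : ∀ ξ : K, (∀ x : K, ‖x‖ ≤ 1 → χ (ξ * x) = 1) ↔ ‖ξ‖ ≤ ‖δ‖) (hδ0 : δ ≠ 0)
    {π : K} (hπ0 : π ≠ 0) (hπ : ∀ x : K, ‖x‖ < 1 ↔ ‖x‖ ≤ ‖π‖) {c : K} (hc : c ≠ 0) :
    ∃ f F : L2 K, (f, F) ∈ fourierGraph χ ∧
      F =ᵐ[haarK K] (Metric.sphere 0 ‖c‖).indicator fun _ => (1 : ℂ) := by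
  obtain ⟨f, F, h, hF⟩ := exists_mem_fourierGraph_closedBall hδ hδ0 hc
  -- The norm is discrete: the open ball of radius `‖c‖` is the closed ball of radius `‖π * c‖`, and
  -- the sphere is the difference of two closed balls.
  obtain ⟨f', F', h', hF'⟩ := exists_mem_fourierGraph_closedBall hδ hδ0 (mul_ne_zero hπ0 hc)
  refine ⟨f - f', F - F', (fourierGraph χ).sub_mem h h', ?_⟩
  filter_upwards [hF, hF', Lp.coeFn_sub F F'] with ξ h1 h2 h3
  rw [h3, Pi.sub_apply, h1, h2]
  have hlt : ‖ξ‖ ≤ ‖π * c‖ ↔ ‖ξ‖ < ‖c‖ := by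
    have h4 := hπ (ξ / c)
    rw [norm_div, div_lt_one (norm_pos_iff.2 hc), div_le_iff₀ (norm_pos_iff.2 hc)] at h4
    rw [norm_mul, h4]
  classical
  simp only [Set.indicator_apply, mem_closedBall_zero_iff, mem_sphere_zero_iff_norm, hlt]
  rcases lt_trichotomy ‖ξ‖ ‖c‖ with h | h | h
  · simp [h, h.le, h.ne]
  · simp [h]
  · simp [h.not_ge, h.not_gt, h.ne']

end FourierBalls

/-! ### Eigenvalues of the `p`-adic Laplacian -/

section Spectrum

set_option linter.unusedSectionVars false

open scoped Classical
open Matrix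

variable {K : Type*} [NontriviallyNormedField K] [IsUltrametricDist K] [ProperSpace K]
  [MeasurableSpace K] [BorelSpace K] {χ : AddChar K Circle} {δ : K}
  {V : Type*} [Fintype V] {G : SimpleGraph V} {Δ : Sym2 V → ℕ}

/-- The residue field has characteristic `p`, and the additive order of `1` divides its cardinality.
-/
theorem le_residueCard (hK : IsNormalized K) {p : ℕ} (hp : p.Prime)
    (hpK : ‖(p : K)‖ < 1) : p ≤ residueCard K := by
  -- An infinite residue field would have `Nat.card = 0`; then normalisation would force every
  -- element of norm below `1` to be zero.
  have hq0 : residueCard K ≠ 0 := by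
    intro h0
    obtain ⟨x, hx0, hx1⟩ := NormedField.exists_norm_lt_one K
    have := hK.2 x hx1
    rw [h0] at this
    simp at this
    simp [this] at hx0
  refine Nat.le_of_dvd (Nat.pos_of_ne_zero hq0) ?_
  set k := IsLocalRing.ResidueField (NormedField.valuation (K := K)).valuationSubring
  have hk : (p : k) = 0 := by
    have h1 : (p : k) = IsLocalRing.residue (NormedField.valuation (K := K)).valuationSubring p := by
      simp
    rw [h1, IsLocalRing.residue_eq_zero_iff, IsLocalRing.mem_maximalIdeal, mem_nonunits_iff]
    intro hu
    obtain ⟨y, hy⟩ := hu.exists_right_inv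
    have h2 : (p : K) * (y : K) = 1 := by exact_mod_cast congrArg Subtype.val hy
    have h3 : ‖(y : K)‖ ≤ 1 := by
      have := y.2
      rw [Valuation.mem_valuationSubring_iff, NormedField.valuation_apply] at this
      exact_mod_cast this
    have h4 := congrArg norm h2
    rw [norm_mul, norm_one] at h4
    nlinarith [norm_nonneg (y : K), norm_nonneg (p : K)]
  have h2 : addOrderOf (1 : k) ∣ p := addOrderOf_dvd_of_nsmul_eq_zero (by simpa using hk)
  rcases (Nat.dvd_prime hp).1 h2 with h3 | h3
  · rw [AddMonoid.addOrderOf_eq_one_iff] at h3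
    exact absurd h3 one_ne_zero
  · rw [← h3]
    exact addOrderOf_dvd_natCard 1

theorem exists_uniformiser (hK : IsNormalized K) (hq : 1 < residueCard K) :
    ∃ π : K, π ≠ 0 ∧ ‖π‖ = (residueCard K : ℝ)⁻¹ ∧ ∀ x : K, ‖x‖ < 1 ↔ ‖x‖ ≤ ‖π‖ := by
  obtain ⟨π, hπ⟩ := hK.1
  have hq' : (1 : ℝ) < residueCard K := by exact_mod_cast hq
  refine ⟨π, ?_, hπ, fun x => ⟨fun h => hπ ▸ hK.2 x h, fun h => h.trans_lt ?_⟩⟩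
  · rw [← norm_pos_iff, hπ]; positivity
  · rw [hπ]; exact inv_lt_one_of_one_lt₀ hq'

theorem norm_eq_zpow (hK : IsNormalized K) (hq : 1 < residueCard K) {x : K} (hx : x ≠ 0) :
    ∃ k : ℤ, ‖x‖ = (residueCard K : ℝ) ^ k := by
  obtain ⟨π, hπ0, hπ, hπ1⟩ := exists_uniformiser hK hq
  have hq' : (1 : ℝ) < residueCard K := by exact_mod_cast hq
  have hq0 : (0 : ℝ) < residueCard K := by linarith
  obtain ⟨k, hk1, hk2⟩ := exists_mem_Ico_zpow (norm_pos_iff.2 hx) hq'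
  refine ⟨k, le_antisymm ?_ hk1⟩
  -- From `q ^ k ≤ ‖x‖ < q ^ (k + 1)`, this product has norm below `1`, hence at most `q⁻¹`, which
  -- leaves only `‖x‖ = q ^ k`.
  have h1 := (hπ1 (x * π ^ (k + 1))).1 (by
    rw [norm_mul, norm_zpow, hπ, _root_.inv_zpow, ← div_eq_mul_inv, div_lt_one (by positivity)]
    exact hk2)
  rw [norm_mul, norm_zpow, hπ, _root_.inv_zpow, ← div_eq_mul_inv, div_le_iff₀ (by positivity),
    zpow_add_one₀ hq0.ne'] at h1
  rwa [mul_comm, mul_assoc, mul_inv_cancel₀ hq0.ne', mul_one] at h1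

theorem laplacianSpec_ne_zero_iff (μ : ℂ) :
    laplacianSpec χ G Δ μ ≠ 0 ↔ ∃ u : V → L2 K, u ≠ 0 ∧ (u, μ • u) ∈ laplacianGraph χ G Δ := by
  rw [laplacianSpec, Ne, Cardinal.toENat_eq_zero, Submodule.rank_eq_zero, ← Ne, Submodule.ne_bot_iff]
  exact exists_congr fun u => and_comm

/-- Let `f` have as transform the indicator of the sphere of radius `y = q ^ k`. Then `Δ^α f = y ^ α
f`, so an eigenvector `x` of `L(y)` gives the eigenfunction with components `x a • f`. -/
theorem laplacianSpec_ne_zero_of_mem_powerSpectrum (hK : IsNormalized K)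
    (hq : 1 < residueCard K)
    (hδ : ∀ ξ : K, (∀ x : K, ‖x‖ ≤ 1 → χ (ξ * x) = 1) ↔ ‖ξ‖ ≤ ‖δ‖) (hδ0 : δ ≠ 0)
    (hχ : Continuous χ) {μ : ℝ} (hμ : μ ∈ powerSpectrum G Δ (residueCard K)) :
    laplacianSpec χ G Δ (μ : ℂ) ≠ 0 := by
  obtain ⟨k, hk⟩ := hμ
  rw [mem_roots (charpoly_monic _).ne_zero, charpoly_isRoot_iff] at hk
  obtain ⟨x, hx0, hx⟩ := hk
  obtain ⟨π, hπ0, hπ, hπ1⟩ := exists_uniformiser hK hq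
  have hc : π ^ (-k) ≠ 0 := zpow_ne_zero _ hπ0
  have hcn : ‖π ^ (-k)‖ = (residueCard K : ℝ) ^ k := by
    rw [norm_zpow, hπ, _root_.inv_zpow, _root_.zpow_neg, inv_inv]
  obtain ⟨f, F, hfF, hF⟩ := exists_mem_fourierGraph_sphere hδ hδ0 hπ0 hπ1 hc
  rw [hcn] at hF
  set y : ℝ := (residueCard K : ℝ) ^ k with hy
  have hy0 : 0 < y := by rw [hy]; positivity
  -- The sphere is open and nonempty, so its indicator is not zero almost everywhere.
  have hf0 : f ≠ 0 := by
    rintro rfl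
    have hF0 := fourierGraph_left_zero hχ hδ hδ0 hfF
    have h1 : (haarK K) (Metric.sphere 0 y) = 0 := by
      have h2 : ∀ᵐ ξ ∂(haarK K), ξ ∉ Metric.sphere (0 : K) y := by
        filter_upwards [hF, (Lp.eq_zero_iff_ae_eq_zero).1 hF0] with ξ h3 h4 h5
        rw [h4, Set.indicator_of_mem h5] at h3
        exact one_ne_zero h3.symm
      exact measure_eq_zero_iff_ae_notMem.2 h2
    have h2 : IsOpen (Metric.sphere (0 : K) y) := IsUltrametricDist.isOpen_sphere 0 hy0.ne'
    exact (h2.measure_pos (haarK K) ⟨π ^ (-k), by simpa using hcn⟩).ne' h1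
  rw [laplacianSpec_ne_zero_iff]
  obtain ⟨a₀, ha₀⟩ := Function.ne_iff.1 hx0
  refine ⟨fun a => (x a : ℂ) • f, fun h => ?_, fun a b => ((x a : ℂ) * (y : ℂ) ^ Δ s(a, b)) • f,
    fun a b hab => ⟨(x a : ℂ) • F, ((x a : ℂ) * (y : ℂ) ^ Δ s(a, b)) • F,
      (fourierGraph χ).smul_mem _ hfF, (fourierGraph χ).smul_mem _ hfF, ?_⟩, fun a => ?_⟩
  · have h1 := congrFun h a₀
    simp only [Pi.zero_apply, smul_eq_zero, Complex.ofReal_eq_zero] at h1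
    exact h1.elim ha₀ hf0
  · filter_upwards [Lp.coeFn_smul (x a : ℂ) F,
      Lp.coeFn_smul ((x a : ℂ) * (y : ℂ) ^ Δ s(a, b)) F, hF] with ξ h1 h2 h3
    rw [h1, h2, Pi.smul_apply, Pi.smul_apply, h3]
    by_cases hξ : ξ ∈ Metric.sphere (0 : K) y
    · rw [Set.indicator_of_mem hξ, mem_sphere_zero_iff_norm.1 hξ]
      simp only [smul_eq_mul]; ring
    · rw [Set.indicator_of_notMem hξ]; simp
  · have h1 := congrFun hx a
    rw [realLaplacian, edgeLaplacian_mulVec, Pi.smul_apply, smul_eq_mul] at h1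
    have h2 : ((μ : ℂ) * (x a : ℂ)) • f =
        (∑ b, if G.Adj a b then (y : ℂ) ^ Δ s(a, b) * ((x a : ℂ) - (x b : ℂ)) else 0) • f := by
      rw [← Complex.ofReal_mul, ← h1]
      congr 1
      push_cast [apply_ite Complex.ofReal]
      rfl
    simp only [Pi.smul_apply, smul_smul]
    rw [h2, Finset.sum_smul]
    refine Finset.sum_congr rfl fun b _ => ?_
    split_ifs
    · rw [← sub_smul, Sym2.eq_swap (a := b)]
      congr 1; ring
    · simp

/-- After the Fourier transform, the eigenvalue equation reads `L(|ξ|) F(ξ) = μ F(ξ)` for almost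
every `ξ`. Any `ξ ≠ 0` with `F(ξ) ≠ 0` provides an eigenvector. -/
theorem mem_powerSpectrum_of_laplacianSpec_ne_zero (hG : G.Connected) (hK : IsNormalized K)
    (hq : 1 < residueCard K)
    (hδ : ∀ ξ : K, (∀ x : K, ‖x‖ ≤ 1 → χ (ξ * x) = 1) ↔ ‖ξ‖ ≤ ‖δ‖) (hδ0 : δ ≠ 0)
    (hχ : Continuous χ) {μ : ℝ} (hμ : laplacianSpec χ G Δ (μ : ℂ) ≠ 0) :
    μ ∈ powerSpectrum G Δ (residueCard K) := by
  have := hG.nonempty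
  rw [laplacianSpec_ne_zero_iff] at hμ
  obtain ⟨u, hu0, d, hd, hsum⟩ := hμ
  obtain ⟨a₀, ha₀⟩ := Function.ne_iff.1 hu0
  -- Without edges nothing places `u` in the Fourier graph, but then the Laplacian is zero. With at
  -- least two vertices, connectivity gives each vertex a neighbour, whose edge supplies a transform
  -- of `u a`.
  rcases subsingleton_or_nontrivial V with hV | hV
  · have h1 := hsum a₀
    rw [Finset.sum_eq_zero fun b _ => if_neg fun hab => hab.ne (Subsingleton.elim _ _)] at h1
    simp only [Pi.smul_apply, smul_eq_zero, Complex.ofReal_eq_zero] at h1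
    rw [h1.resolve_right ha₀]
    exact ⟨0, zero_mem_roots_realLaplacian G Δ _⟩
  have huniq : ∀ {f F F' : L2 K}, (f, F) ∈ fourierGraph χ → (f, F') ∈ fourierGraph χ → F = F' :=
    fun h h' => fourierGraph_unique hχ hδ hδ0 h h'
  choose! F₁ H hF₁ hH hFH using hd
  have hF : ∀ a, ∃ F : L2 K, (u a, F) ∈ fourierGraph χ := fun a => by
    obtain ⟨b, hb⟩ := hG.preconnected.exists_adj_of_nontrivial a
    exact ⟨_, hF₁ a b hb⟩
  choose F hF using hF
  have hmain : ∀ a, (μ : ℂ) • F a = ∑ b, if G.Adj a b then H a b - H b a else 0 := by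
    intro a
    refine huniq ((fourierGraph χ).smul_mem (μ : ℂ) (hF a)) ?_
    have h1 : ((μ : ℂ) • u) a = _ := hsum a
    rw [Pi.smul_apply] at h1
    have h2 : (∑ b, if G.Adj a b then (d a b - d b a, H a b - H b a) else 0) ∈ fourierGraph χ := by
      refine Submodule.sum_mem _ fun b _ => ?_
      split_ifs with hab
      · exact (fourierGraph χ).sub_mem (hH a b hab) (hH b a hab.symm)
      · exact Submodule.zero_mem _
    convert h2 using 1
    refine Prod.ext ?_ ?_
    · rw [Prod.fst_sum]
      refine h1.trans (Finset.sum_congr rfl fun b _ => ?_)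
      split_ifs <;> rfl
    · rw [Prod.snd_sum]
      refine Finset.sum_congr rfl fun b _ => ?_
      split_ifs <;> rfl
  have hF0 : ¬ F a₀ =ᵐ[haarK K] 0 := by
    intro h
    have h1 := hF a₀
    rw [(Lp.eq_zero_iff_ae_eq_zero).2 h] at h1
    exact ha₀ (fourierGraph_right_zero hχ hδ hδ0 h1)
  have hae : ∀ᵐ ξ ∂(haarK K), ∀ a, (μ : ℂ) * F a ξ =
      ∑ b, if G.Adj a b then (‖ξ‖ : ℂ) ^ Δ s(a, b) * (F a ξ - F b ξ) else 0 := by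
    have hHae : ∀ a b, ∀ᵐ ξ ∂(haarK K), G.Adj a b →
        H a b ξ = (‖ξ‖ : ℂ) ^ Δ s(a, b) * F a ξ := by
      intro a b
      by_cases hab : G.Adj a b
      · filter_upwards [hFH a b hab] with ξ hξ _
        rw [hξ, huniq (hF₁ a b hab) (hF a)]
      · exact Filter.Eventually.of_forall fun _ h => absurd h hab
    have hterm : ∀ a b, ∀ᵐ ξ ∂(haarK K),
        (if G.Adj a b then H a b - H b a else 0 : L2 K) ξ =
          if G.Adj a b then (‖ξ‖ : ℂ) ^ Δ s(a, b) * (F a ξ - F b ξ) else 0 := by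
      intro a b
      by_cases hab : G.Adj a b
      · simp only [if_pos hab]
        filter_upwards [hHae a b, hHae b a, Lp.coeFn_sub (H a b) (H b a)] with ξ h1 h2 h3
        rw [h3, Pi.sub_apply, h1 hab, h2 hab.symm, Sym2.eq_swap (a := b)]
        ring
      · simp only [if_neg hab]
        filter_upwards [Lp.coeFn_zero ℂ 2 (haarK K)] with ξ h1
        rw [h1, Pi.zero_apply]
    refine Filter.eventually_all.2 fun a => ?_
    have hsumae : ∀ s : Finset V, ∀ᵐ ξ ∂(haarK K),
        (∑ b ∈ s, if G.Adj a b then H a b - H b a else 0 : L2 K) ξ =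
          ∑ b ∈ s, if G.Adj a b then (‖ξ‖ : ℂ) ^ Δ s(a, b) * (F a ξ - F b ξ) else 0 := by
      intro s
      induction s using Finset.induction_on with
      | empty =>
        simp only [Finset.sum_empty]
        filter_upwards [Lp.coeFn_zero ℂ 2 (haarK K)] with ξ h1
        rw [h1, Pi.zero_apply]
      | insert b s hb ih =>
        simp only [Finset.sum_insert hb]
        filter_upwards [ih, hterm a b, Lp.coeFn_add (if G.Adj a b then H a b - H b a else 0 : L2 K)
          (∑ b ∈ s, if G.Adj a b then H a b - H b a else 0 : L2 K)] with ξ h1 h2 h3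
        rw [h3, Pi.add_apply, h1, h2]
    filter_upwards [hsumae Finset.univ, Lp.coeFn_smul (μ : ℂ) (F a)] with ξ h1 h2
    rw [← h1, ← hmain a, h2, Pi.smul_apply, smul_eq_mul]
  have hne0 : ∀ᵐ ξ ∂(haarK K), ξ ≠ 0 := by
    simp [ae_iff]
  obtain ⟨ξ, hξ1, hξ2, hξ0⟩ :=
    ((Filter.not_eventually.1 hF0).and_eventually (hae.and hne0)).exists
  obtain ⟨k, hk⟩ := norm_eq_zpow hK hq hξ0
  refine ⟨k, ?_⟩
  rw [mem_roots (charpoly_monic _).ne_zero, charpoly_isRoot_iff, ← hk]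
  -- The matrix and `μ` are real, so real and imaginary part of the complex eigenvector satisfy the
  -- same equation, and one of them is nonzero.
  by_cases hre : ∀ a, (F a ξ).re = 0
  · refine ⟨fun a => (F a ξ).im, fun h => hξ1 (Complex.ext (hre a₀) (congrFun h a₀)), ?_⟩
    ext a
    have h1 := congrArg Complex.im (hξ2 a)
    rw [realLaplacian, edgeLaplacian_mulVec, Pi.smul_apply, smul_eq_mul]
    rw [Complex.im_ofReal_mul, Complex.im_sum] at h1
    rw [h1]
    refine Finset.sum_congr rfl fun b _ => ?_
    split_ifs
    · rw [← Complex.ofReal_pow, Complex.im_ofReal_mul, Complex.sub_im]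
    · rfl
  · refine ⟨fun a => (F a ξ).re, fun h => hre fun a => congrFun h a, ?_⟩
    ext a
    have h1 := congrArg Complex.re (hξ2 a)
    rw [realLaplacian, edgeLaplacian_mulVec, Pi.smul_apply, smul_eq_mul]
    rw [Complex.re_ofReal_mul, Complex.re_sum] at h1
    rw [h1]
    refine Finset.sum_congr rfl fun b _ => ?_
    split_ifs
    · rw [← Complex.ofReal_pow, Complex.re_ofReal_mul, Complex.sub_re]
    · rfl

end Spectrum

/-! ### Multi-affine expansion of the characteristic polynomial -/

section Expansion

open scoped Classical
open Matrix

variable {V V' : Type*} [Fintype V] [Fintype V']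

/-- The determinant is affine along a rank-one perturbation. -/
theorem det_add_smul_vecMulVec {R : Type*} [CommRing R] (N : Matrix V V R) (v : V → R) (w : R) :
    (N + w • vecMulVec v v).det = (1 - w) * N.det + w * (N + vecMulVec v v).det := by
  -- The Schur complement of this bordered matrix is `N + v rᵀ`, and `r` occurs in the last row
  -- only. The row `(w v, 1)` is `(1 - w) (0, 1) + w (v, 1)`, so linearity in that row gives the
  -- formula.
  let Z : (V → R) → Matrix (V ⊕ Unit) (V ⊕ Unit) R := fun r =>
    fromBlocks N (replicateCol Unit (-v)) (replicateRow Unit r) 1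
  have hZ : ∀ r, (Z r).det = (N + vecMulVec v r).det := by
    intro r
    rw [det_fromBlocks_one₂₂]
    congr 1
    ext i j
    simp [Matrix.mul_apply, vecMulVec_apply]
  have hrow : ∀ r, Z r = (Z 0).updateRow (Sum.inr ()) (Sum.elim r 1) := by
    intro r
    ext i j
    rcases i with i | i <;> rcases j with j | j <;> simp [Z, updateRow_apply]
  have hlin : (Sum.elim (w • v) 1 : V ⊕ Unit → R) =
      (1 - w) • Sum.elim (0 : V → R) (1 : Unit → R) + w • Sum.elim v (1 : Unit → R) := by
    ext i
    rcases i with i | i <;> simp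
  have h1 := hZ (w • v)
  rw [hrow, hlin, det_updateRow_add, det_updateRow_smul, det_updateRow_smul, ← hrow, ← hrow,
    hZ, hZ, vecMulVec_zero, add_zero] at h1
  rw [h1]
  congr 2
  ext i j
  simp [vecMulVec_apply]
  ring

/-- The determinant is affine in each weight separately. The coefficients are chosen before the ring
`R`, so that the same ones serve for the weights `Y ^ a` and for integer weights. -/
theorem exists_det_expansion {ι A : Type*} [CommRing A] (s : Finset ι) (b : ι → V → A)
    (M : Matrix V V A) : ∃ c : Finset ι → A, ∀ (R : Type) [CommRing R] (f : A →+* R) (w : ι → R),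
      (M.map f + ∑ i ∈ s, w i • vecMulVec (f ∘ b i) (f ∘ b i)).det =
        ∑ S ∈ s.powerset, f (c S) * ∏ i ∈ S, w i := by
  induction s using Finset.induction_on generalizing M with
  | empty =>
    refine ⟨fun _ => M.det, fun R _ f w => ?_⟩
    simp [RingHom.map_det]
  | insert i s hi ih =>
    obtain ⟨c₀, h₀⟩ := ih M
    obtain ⟨c₁, h₁⟩ := ih (M + vecMulVec (b i) (b i))
    refine ⟨fun S => if i ∈ S then c₁ (S.erase i) - c₀ (S.erase i) else c₀ S,
      fun R _ f w => ?_⟩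
    have hmap : (M + vecMulVec (b i) (b i)).map f =
        M.map f + vecMulVec (f ∘ b i) (f ∘ b i) := by
      ext j k; simp [vecMulVec_apply]
    have h₁' := h₁ R f w
    rw [hmap, add_right_comm] at h₁'
    rw [Finset.sum_insert hi, add_comm (w i • _), ← add_assoc, det_add_smul_vecMulVec, h₀, h₁',
      Finset.sum_powerset_insert hi, Finset.mul_sum, Finset.mul_sum, ← Finset.sum_add_distrib,
      ← Finset.sum_add_distrib]
    refine Finset.sum_congr rfl fun S hS => ?_
    have hiS : i ∉ S := fun h => hi (Finset.mem_powerset.1 hS h)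
    beta_reduce
    rw [if_neg hiS, if_pos (Finset.mem_insert_self i S), Finset.erase_insert hiS,
      Finset.prod_insert hiS, map_sub]
    ring

/-- The characteristic polynomial of a weighted Laplacian is multi-affine in the weights. -/
theorem exists_charpoly_expansion {G : SimpleGraph V} {Δ : Sym2 V → ℕ} {A : Finset ℕ}
    (h : IsLabelling (A : Set ℕ) G Δ) : ∃ c : Finset ℕ → ℤ[X], ∀ (R : Type) [CommRing R]
      (w : ℕ → R), (edgeLaplacian G fun e => w (Δ e)).charpoly =
        ∑ S ∈ A.powerset, (c S).map (Int.castRingHom R) * ∏ a ∈ S, -C (w a) := by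
  have hb := fun a => exists_edgeLaplacian_label ℤ[X] h.2 a
  choose b hb using hb
  obtain ⟨c, hc⟩ := exists_det_expansion A b (scalar V (X : ℤ[X]))
  refine ⟨c, fun R _ w => ?_⟩
  have h1 := hc R[X] (mapRingHom (Int.castRingHom R)) (fun a => -C (w a))
  simp only [coe_mapRingHom] at h1
  rw [← h1, Matrix.charpoly]
  congr 1
  have h2 : (edgeLaplacian G fun e => w (Δ e)).map C = ∑ a ∈ A, C (w a) •
      vecMulVec (Polynomial.map (Int.castRingHom R) ∘ b a)
        (Polynomial.map (Int.castRingHom R) ∘ b a) := by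
    have h3 : ∀ a, vecMulVec (Polynomial.map (Int.castRingHom R) ∘ b a)
        (Polynomial.map (Int.castRingHom R) ∘ b a) =
        edgeLaplacian G fun e => if Δ e = a then (1 : R[X]) else 0 := by
      intro a
      have h4 := congrArg (fun M => M.map (mapRingHom (Int.castRingHom R))) (hb a)
      simp only [edgeLaplacian_map] at h4
      have h5 : vecMulVec (Polynomial.map (Int.castRingHom R) ∘ b a)
        (Polynomial.map (Int.castRingHom R) ∘ b a) =
          (vecMulVec (b a) (b a)).map (mapRingHom (Int.castRingHom R)) := by
        ext1 i j; simp [vecMulVec_apply]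
      rw [h5, ← h4]
      congr 1
      ext1 e
      split_ifs <;> simp
    simp only [h3, ← edgeLaplacian_smul]
    rw [← edgeLaplacian_sum, edgeLaplacian_map]
    refine edgeLaplacian_congr fun e he => ?_
    simp only [mul_ite, mul_one, mul_zero]
    rw [Finset.sum_ite_eq, if_pos (Finset.mem_coe.1 (h.1 he))]
  rw [charmatrix, RingHom.mapMatrix_apply, h2, sub_eq_add_neg, ← Finset.sum_neg_distrib]
  congr 1
  · ext1 i j
    rcases eq_or_ne i j with rfl | hij <;> simp [*]
  · simp

/-- The weights `Y ^ a` turn the monomial of a set `S` of labels into `± Y ^ ∑ S`. As subset sums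
differ, the coefficient of each `S` can be read off, and it determines the characteristic polynomial
for all other weights. -/
theorem charpoly_eq_of_spectralPolynomial_eq {G : SimpleGraph V} {Δ : Sym2 V → ℕ}
    {G' : SimpleGraph V'} {Δ' : Sym2 V' → ℕ} {A : Finset ℕ}
    (h : IsLabelling (A : Set ℕ) G Δ) (h' : IsLabelling (A : Set ℕ) G' Δ')
    (hA : DistinctSubsetSums (A : Set ℕ))
    (hP : spectralPolynomial G Δ = spectralPolynomial G' Δ') (w : ℕ → ℤ) :
    (edgeLaplacian G fun e => w (Δ e)).charpoly = (edgeLaplacian G' fun e => w (Δ' e)).charpoly := by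
  obtain ⟨c, hc⟩ := exists_charpoly_expansion h
  obtain ⟨c', hc'⟩ := exists_charpoly_expansion h'
  rw [hc, hc']
  refine Finset.sum_congr rfl fun S hS => ?_
  congr 2
  ext j
  have hprod : ∀ T : Finset ℕ, ∏ a ∈ T, -C ((X : ℤ[X]) ^ a) =
      C (C ((-1) ^ T.card) * (X : ℤ[X]) ^ ∑ a ∈ T, a) := by
    intro T
    have h1 : ∀ a, -C ((X : ℤ[X]) ^ a) = C (C (-1) * X ^ a) := by simp
    simp only [h1]
    rw [← map_prod, Finset.prod_mul_distrib, Finset.prod_const, Finset.prod_pow_eq_pow_sum, C_pow]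
  have hcoeff : ∀ c : Finset ℕ → ℤ[X], ((∑ T ∈ A.powerset, (c T).map (Int.castRingHom ℤ[X]) *
      ∏ a ∈ T, -C ((X : ℤ[X]) ^ a)).coeff j).coeff (∑ a ∈ S, a) =
      (c S).coeff j * (-1) ^ S.card := by
    intro c
    rw [finsetSum_coeff, finsetSum_coeff, Finset.sum_eq_single S]
    · rw [hprod, coeff_mul_C, coeff_map, eq_intCast, ← C_eq_intCast, ← mul_assoc, ← C_mul,
        coeff_C_mul_X_pow, if_pos rfl]
      simp
    · intro T hT hTS
      rw [hprod, coeff_mul_C, coeff_map, eq_intCast, ← C_eq_intCast, ← mul_assoc, ← C_mul,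
        coeff_C_mul_X_pow, if_neg]
      intro hsum
      refine hTS (hA _ _ ?_ ?_ hsum.symm) <;>
        simpa using Finset.mem_powerset.1 ‹_›
    · exact fun hn => absurd hS hn
  rw [spectralPolynomial, weightedLaplacian_eq, spectralPolynomial, weightedLaplacian_eq,
    hc ℤ[X] fun a => X ^ a, hc' ℤ[X] fun a => X ^ a] at hP
  have h1 := hcoeff c
  rw [hP, hcoeff c'] at h1
  exact (mul_right_cancel₀ (pow_ne_zero _ (by norm_num)) h1).symm

/-- The trace is a coefficient of the spectral polynomial and equals the sum of `Y ^ Δ s(a, b)` over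
ordered adjacent pairs. With distinct labels, its exponents list the edges. -/
theorem graph_eq_of_spectralPolynomial_eq [Nonempty V] {Δ : Sym2 V → ℕ}
    (hΔ : Set.InjOn Δ {e | ¬ e.IsDiag}) {G G' : SimpleGraph V}
    (hP : spectralPolynomial G Δ = spectralPolynomial G' Δ) : G = G' := by
  have htr : ∀ G : SimpleGraph V, (weightedLaplacian G Δ).trace =
      ∑ a, ∑ g, if G.Adj a g then (X : ℤ[X]) ^ Δ s(a, g) else 0 := by
    intro G
    simp [Matrix.trace, weightedLaplacian]
  have h1 : (weightedLaplacian G Δ).trace = (weightedLaplacian G' Δ).trace := by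
    rw [spectralPolynomial, spectralPolynomial] at hP
    rw [trace_eq_neg_charpoly_coeff, trace_eq_neg_charpoly_coeff, hP]
  have hadj : ∀ (G : SimpleGraph V) (u v : V), u ≠ v →
      (G.Adj u v ↔ (weightedLaplacian G Δ).trace.coeff (Δ s(u, v)) ≠ 0) := by
    intro G u v huv
    have h2 : (weightedLaplacian G Δ).trace.coeff (Δ s(u, v)) =
        ((∑ a, ∑ g, if G.Adj a g ∧ s(a, g) = s(u, v) then 1 else 0 : ℕ) : ℤ) := by
      rw [htr, finsetSum_coeff]
      push_cast
      refine Finset.sum_congr rfl fun a _ => ?_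
      rw [finsetSum_coeff]
      refine Finset.sum_congr rfl fun g _ => ?_
      by_cases hag : G.Adj a g
      · simp only [hag, if_true, true_and, coeff_X_pow]
        refine if_congr ?_ rfl rfl
        rw [eq_comm]
        exact hΔ.eq_iff (by simpa using hag.ne) (by simpa using huv)
      · simp [hag]
    rw [h2, Nat.cast_ne_zero]
    constructor
    · intro h h0
      rw [Finset.sum_eq_zero_iff] at h0
      have h3 := h0 u (Finset.mem_univ u)
      rw [Finset.sum_eq_zero_iff] at h3
      simpa [h] using h3 v (Finset.mem_univ v)
    · intro h
      obtain ⟨a, -, ha⟩ := Finset.exists_ne_zero_of_sum_ne_zero h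
      obtain ⟨g, -, hg⟩ := Finset.exists_ne_zero_of_sum_ne_zero ha
      have h3 : G.Adj a g ∧ s(a, g) = s(u, v) := by
        by_contra h4
        exact hg (if_neg h4)
      have h4 : s(a, g) ∈ G.edgeSet := h3.1
      rw [h3.2] at h4
      exact h4
  ext u v
  by_cases huv : u = v
  · subst huv; simp
  · rw [hadj G u v huv, hadj G' u v huv, h1]

theorem card_eq_of_spectralPolynomial_eq {G : SimpleGraph V} {Δ : Sym2 V → ℕ}
    {G' : SimpleGraph V'} {Δ' : Sym2 V' → ℕ}
    (hP : spectralPolynomial G Δ = spectralPolynomial G' Δ') :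
    Fintype.card V = Fintype.card V' := by
  have h := congrArg natDegree hP
  rwa [spectralPolynomial, spectralPolynomial, charpoly_natDegree_eq_dim,
    charpoly_natDegree_eq_dim] at h

end Expansion

/-! ### Incidence of labels with vertices -/

section Incidence

open scoped Classical
open Matrix

/-- The vertex `v` lies on an edge with label `a`. -/
def LabelIncident {V : Type*} (G : SimpleGraph V) (Δ : Sym2 V → ℕ) (v : V) (a : ℕ) : Prop :=
  ∃ u, G.Adj v u ∧ Δ s(v, u) = a

section Basic

variable {V : Type*} {G : SimpleGraph V} {Δ : Sym2 V → ℕ}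

/-- A label determines its edge, so two different vertices on it are its two ends. -/
theorem LabelIncident.adj_of_ne (hΔ : Set.InjOn Δ G.edgeSet) {u v : V} {a : ℕ} (huv : u ≠ v)
    (hu : LabelIncident G Δ u a) (hv : LabelIncident G Δ v a) : G.Adj u v ∧ Δ s(u, v) = a := by
  obtain ⟨x, hx, hxa⟩ := hu
  obtain ⟨y, hy, hya⟩ := hv
  have h : s(u, x) = s(v, y) := hΔ hx hy (hxa.trans hya.symm)
  rw [Sym2.eq_iff] at h
  rcases h with ⟨h, -⟩ | ⟨-, rfl⟩
  · exact absurd h huv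
  · exact ⟨hx, hxa⟩

theorem LabelIncident.eq_or_eq (hΔ : Set.InjOn Δ G.edgeSet) {u v w : V} {a : ℕ}
    (huv : G.Adj u v) (ha : Δ s(u, v) = a) (hw : LabelIncident G Δ w a) : w = u ∨ w = v := by
  by_contra! h
  have hu : LabelIncident G Δ u a := ⟨v, huv, ha⟩
  have h1 := (hw.adj_of_ne hΔ h.1 hu)
  have h2 : s(w, u) = s(u, v) := hΔ h1.1 huv (h1.2.trans ha.symm)
  rw [Sym2.eq_iff] at h2
  rcases h2 with h2 | h2
  · exact h.1 h2.1
  · exact h.2 h2.1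

theorem labelIncident_left {u v : V} (huv : G.Adj u v) : LabelIncident G Δ u (Δ s(u, v)) :=
  ⟨v, huv, rfl⟩

theorem labelIncident_right {u v : V} (huv : G.Adj u v) : LabelIncident G Δ v (Δ s(u, v)) :=
  ⟨u, huv.symm, by rw [Sym2.eq_swap]⟩

theorem LabelIncident.label_eq (hΔ : Set.InjOn Δ G.edgeSet) {u v : V} {a b : ℕ} (huv : u ≠ v)
    (hua : LabelIncident G Δ u a) (hva : LabelIncident G Δ v a) (hub : LabelIncident G Δ u b)
    (hvb : LabelIncident G Δ v b) : a = b :=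
  (hua.adj_of_ne hΔ huv hva).2.symm.trans (hub.adj_of_ne hΔ huv hvb).2

theorem eq_or_eq_of_connected (hG : G.Connected) {u v : V} (hu : ∀ x, G.Adj u x → x = v)
    (hv : ∀ x, G.Adj v x → x = u) (x : V) : x = u ∨ x = v := by
  obtain ⟨p⟩ := hG.preconnected u x
  have key : ∀ {y x : V}, G.Walk y x → y = u ∨ y = v → x = u ∨ x = v := by
    intro y x p
    induction p with
    | nil => exact id
    | cons h _ ih =>
      rintro (rfl | rfl)
      · exact ih (Or.inr (hu _ h))
      · exact ih (Or.inl (hv _ h))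
  exact key p (Or.inl rfl)

end Basic

/-! ### Eigenvalue tests for common vertices -/

section Tests

variable {V : Type*} [Fintype V]

/-- The integer `μ` is an eigenvalue of the unweighted Laplacian of the edges with label in `T`. -/
def IsLabelEigenvalue (G : SimpleGraph V) (Δ : Sym2 V → ℕ) (T : Finset ℕ) (μ : ℤ) : Prop :=
  ∃ x : V → ℤ, x ≠ 0 ∧
    ∑ a ∈ T, edgeLaplacian G (fun e => if Δ e = a then (1 : ℤ) else 0) *ᵥ x = μ • x

theorem isLabelEigenvalue_iff (G : SimpleGraph V) (Δ : Sym2 V → ℕ) (T : Finset ℕ) (μ : ℤ) :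
    IsLabelEigenvalue G Δ T μ ↔
      (edgeLaplacian G fun e => if Δ e ∈ T then (1 : ℤ) else 0).charpoly.IsRoot μ := by
  rw [charpoly_isRoot_iff, IsLabelEigenvalue]
  refine exists_congr fun x => and_congr_right fun _ => ?_
  rw [← Matrix.sum_mulVec, ← edgeLaplacian_sum]
  simp

variable {G : SimpleGraph V} {Δ : Sym2 V → ℕ}

theorem label_mulVec (hΔ : Set.InjOn Δ G.edgeSet) {u v : V} {a : ℕ} (huv : G.Adj u v)
    (ha : Δ s(u, v) = a) (x : V → ℤ) :
    edgeLaplacian G (fun e => if Δ e = a then (1 : ℤ) else 0) *ᵥ x =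
      (x u - x v) • (Pi.single u 1 - Pi.single v 1) := by
  have h : edgeLaplacian G (fun e => if Δ e = a then (1 : ℤ) else 0) =
      edgeLaplacian G (fun e => if e = s(u, v) then (1 : ℤ) else 0) :=
    edgeLaplacian_congr fun e he => if_congr (by rw [← ha]; exact hΔ.eq_iff he huv) rfl rfl
  rw [h, edgeLaplacian_single huv, vecMulVec_mulVec, sub_dotProduct, single_dotProduct,
    single_dotProduct, one_mul, one_mul]
  ext i
  simp [mul_comm]

/-- A single edge has the eigenvalue `2`; the empty graph has only `0`. -/
theorem exists_labelIncident_iff (hΔ : Set.InjOn Δ G.edgeSet) (a : ℕ) :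
    (∃ v, LabelIncident G Δ v a) ↔ IsLabelEigenvalue G Δ {a} 2 := by
  constructor
  · rintro ⟨v, u, hvu, ha⟩
    refine ⟨Pi.single v 1 - Pi.single u 1, fun h => ?_, ?_⟩
    · have := congrFun h v
      simp [hvu.ne] at this
    · rw [Finset.sum_singleton, label_mulVec hΔ hvu ha]
      simp [hvu.ne, hvu.ne']
  · rintro ⟨x, hx0, hx⟩
    by_contra! hne
    rw [Finset.sum_singleton, edgeLaplacian_mulVec_eq_zero] at hx
    · exact hx0 ((smul_eq_zero.1 hx.symm).resolve_left (by norm_num))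
    · exact fun u v huv => Or.inl (if_neg fun h => hne u ⟨v, huv, h⟩)

/-- Two edges with a common vertex form a path with eigenvalues `0, 1, 3`; two disjoint edges have
only `0` and `2`. -/
theorem exists_common_vertex_iff (hΔ : Set.InjOn Δ G.edgeSet) {a b : ℕ} (hab : a ≠ b)
    (ha : ∃ v, LabelIncident G Δ v a) (hb : ∃ v, LabelIncident G Δ v b) :
    (∃ v, LabelIncident G Δ v a ∧ LabelIncident G Δ v b) ↔ IsLabelEigenvalue G Δ {a, b} 3 := by
  constructor
  · rintro ⟨v, ⟨p, hp, hpa⟩, ⟨r, hr, hrb⟩⟩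
    have hpr : p ≠ r := by
      rintro rfl
      exact hab (hpa.symm.trans hrb)
    refine ⟨Pi.single p 1 + Pi.single r 1 - 2 • Pi.single v 1, fun h => ?_, ?_⟩
    · have := congrFun h v
      simp [hp.ne, hr.ne] at this
    · rw [Finset.sum_pair hab, label_mulVec hΔ hp hpa, label_mulVec hΔ hr hrb]
      ext i
      simp [hp.ne, hp.ne', hr.ne, hr.ne', hpr, hpr.symm]
      ring
  · rintro ⟨x, hx0, hx⟩
    obtain ⟨u, v, huv, ha⟩ := ha
    obtain ⟨w, z, hwz, hb⟩ := hb
    by_contra! hne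
    have hua : LabelIncident G Δ u a := ⟨v, huv, ha⟩
    have hva : LabelIncident G Δ v a := ⟨u, huv.symm, by rwa [Sym2.eq_swap]⟩
    have hwb : LabelIncident G Δ w b := ⟨z, hwz, hb⟩
    have hzb : LabelIncident G Δ z b := ⟨w, hwz.symm, by rwa [Sym2.eq_swap]⟩
    have huw : u ≠ w := fun h => hne u hua (h ▸ hwb)
    have huz : u ≠ z := fun h => hne u hua (h ▸ hzb)
    have hvw : v ≠ w := fun h => hne v hva (h ▸ hwb)
    have hvz : v ≠ z := fun h => hne v hva (h ▸ hzb)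
    rw [Finset.sum_pair hab, label_mulVec hΔ huv ha, label_mulVec hΔ hwz hb] at hx
    have hu := congrFun hx u
    have hv := congrFun hx v
    have hw := congrFun hx w
    have hz := congrFun hx z
    simp [huw, huz, huv.ne] at hu
    simp [hvw, hvz, huv.ne'] at hv
    simp [huw.symm, hvw.symm, hwz.ne] at hw
    simp [huz.symm, hvz.symm, hwz.ne'] at hz
    have h1 : x u - x v = 0 := by omega
    have h2 : x w - x z = 0 := by omega
    rw [h1, h2, zero_smul, zero_smul, add_zero] at hx
    exact hx0 ((smul_eq_zero.1 hx.symm).resolve_left (by norm_num))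

/-- Three edges that meet pairwise form a claw or a triangle, which have the same line graph. The
claw has the eigenvalue `4`; the triangle has only `0` and `3`. -/
theorem exists_common_vertex_three_iff (hΔ : Set.InjOn Δ G.edgeSet) {a b c : ℕ} (hab : a ≠ b)
    (hac : a ≠ c) (hbc : b ≠ c) (h₁ : ∃ v, LabelIncident G Δ v a ∧ LabelIncident G Δ v b)
    (h₂ : ∃ v, LabelIncident G Δ v b ∧ LabelIncident G Δ v c)
    (h₃ : ∃ v, LabelIncident G Δ v a ∧ LabelIncident G Δ v c) :
    (∃ v, LabelIncident G Δ v a ∧ LabelIncident G Δ v b ∧ LabelIncident G Δ v c) ↔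
      IsLabelEigenvalue G Δ {a, b, c} 4 := by
  have hsum : ∀ f : ℕ → V → ℤ, ∑ i ∈ {a, b, c}, f i = f a + f b + f c := by
    intro f
    rw [Finset.sum_insert (by simp [hab, hac]), Finset.sum_pair hbc, add_assoc]
  constructor
  · rintro ⟨v, ⟨p, hp, hpa⟩, ⟨r, hr, hrb⟩, ⟨s, hs, hsc⟩⟩
    have hpr : p ≠ r := by
      rintro rfl
      exact hab (hpa.symm.trans hrb)
    have hps : p ≠ s := by
      rintro rfl
      exact hac (hpa.symm.trans hsc)
    have hrs : r ≠ s := by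
      rintro rfl
      exact hbc (hrb.symm.trans hsc)
    refine ⟨3 • Pi.single v 1 - Pi.single p 1 - Pi.single r 1 - Pi.single s 1, fun h => ?_, ?_⟩
    · have := congrFun h v
      simp [hp.ne, hr.ne, hs.ne] at this
    · rw [hsum, label_mulVec hΔ hp hpa, label_mulVec hΔ hr hrb, label_mulVec hΔ hs hsc]
      ext i
      simp [hp.ne, hp.ne', hr.ne, hr.ne', hs.ne, hs.ne', hpr, hpr.symm, hps, hps.symm, hrs,
        hrs.symm]
      ring
  · rintro ⟨x, hx0, hx⟩
    by_contra! hne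
    obtain ⟨u, hua, hub⟩ := h₁
    obtain ⟨v, hvb, hvc⟩ := h₂
    obtain ⟨w, hwa, hwc⟩ := h₃
    have huv : u ≠ v := fun h => hne u hua hub (h ▸ hvc)
    have huw : u ≠ w := fun h => hne u hua hub (h ▸ hwc)
    have hvw : v ≠ w := fun h => hne w hwa (h ▸ hvb) hwc
    obtain ⟨h1, h1'⟩ := hua.adj_of_ne hΔ huw hwa
    obtain ⟨h2, h2'⟩ := hub.adj_of_ne hΔ huv hvb
    obtain ⟨h3, h3'⟩ := hvc.adj_of_ne hΔ hvw hwc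
    rw [hsum, label_mulVec hΔ h1 h1', label_mulVec hΔ h2 h2', label_mulVec hΔ h3 h3'] at hx
    have hu := congrFun hx u
    have hv := congrFun hx v
    have hw := congrFun hx w
    simp [huv, huw] at hu
    simp [huv.symm, hvw] at hv
    simp [huw.symm, hvw.symm] at hw
    have e1 : x u = 0 := by omega
    have e2 : x v = 0 := by omega
    have e3 : x w = 0 := by omega
    rw [e1, e2, e3, sub_zero, zero_smul, zero_smul, zero_smul, add_zero, add_zero] at hx
    exact hx0 ((smul_eq_zero.1 hx.symm).resolve_left (by norm_num))

end Tests

/-! ### Vertices from labels -/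

section Reconstruction

set_option linter.unusedSectionVars false

variable {V V' : Type*} [Fintype V] [Fintype V'] {G : SimpleGraph V} {Δ : Sym2 V → ℕ}
  {G' : SimpleGraph V'} {Δ' : Sym2 V' → ℕ}

theorem labelIncident_iff_of_card_le_two (hV : Fintype.card V ≤ 2) (v : V) (a : ℕ) :
    LabelIncident G Δ v a ↔ ∃ u, LabelIncident G Δ u a := by
  refine ⟨fun h => ⟨v, h⟩, ?_⟩
  rintro ⟨u, w, huw, ha⟩
  by_cases hvu : v = u
  · exact hvu ▸ ⟨w, huw, ha⟩
  by_cases hvw : v = w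
  · subst hvw
    exact ⟨u, huw.symm, by rwa [Sym2.eq_swap]⟩
  have h1 : ({v, u, w} : Finset V).card = 3 := Finset.card_eq_three.2 ⟨v, u, w, hvu, hvw, huw.ne, rfl⟩
  have h2 := Finset.card_le_univ ({v, u, w} : Finset V)
  omega

theorem not_two_closed (hG : G.Connected) (hV : 2 < Fintype.card V) {u v : V}
    (hu : ∀ x, G.Adj u x → x = v) (hv : ∀ x, G.Adj v x → x = u) : False := by
  have h1 : (Finset.univ : Finset V) ⊆ {u, v} := fun x _ => by
    simpa using eq_or_eq_of_connected hG hu hv x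
  have h2 := (Finset.card_le_card h1).trans Finset.card_le_two
  rw [Finset.card_univ] at h2
  omega

/-- Two different vertices with the same labels would have only each other as neighbours, hence form
a whole component. -/
theorem eq_of_labelIncident_iff (hG : G.Connected) (hV : 2 < Fintype.card V)
    (hΔ : Set.InjOn Δ G.edgeSet) {u v : V}
    (h : ∀ a, LabelIncident G Δ u a ↔ LabelIncident G Δ v a) : u = v := by
  by_contra huv
  refine not_two_closed hG hV (u := u) (v := v) (fun x hx => ?_) (fun x hx => ?_)
  · exact ((((h _).1 (labelIncident_left hx)).eq_or_eq hΔ hx rfl).resolve_left (Ne.symm huv)).symm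
  · exact ((((h _).2 (labelIncident_left hx)).eq_or_eq hΔ hx rfl).resolve_left huv).symm

/-- Label-preserving line graph isomorphisms that respect claws come from vertex maps. -/
theorem exists_labelIncident_iff_of_card (hG : G.Connected) (hV : 2 < Fintype.card V)
    (hΔ : Set.InjOn Δ G.edgeSet) (hΔ' : Set.InjOn Δ' G'.edgeSet)
    (h₂ : ∀ a b, a ≠ b → ((∃ v, LabelIncident G Δ v a ∧ LabelIncident G Δ v b) ↔
      ∃ v, LabelIncident G' Δ' v a ∧ LabelIncident G' Δ' v b))
    (h₃ : ∀ a b c, a ≠ b → a ≠ c → b ≠ c →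
      ((∃ v, LabelIncident G Δ v a ∧ LabelIncident G Δ v b ∧ LabelIncident G Δ v c) ↔
        ∃ v, LabelIncident G' Δ' v a ∧ LabelIncident G' Δ' v b ∧ LabelIncident G' Δ' v c))
    (v : V) : ∃ v', ∀ a, LabelIncident G Δ v a ↔ LabelIncident G' Δ' v' a := by
  -- Two labels have at most one common vertex, so they pin down `v'`; the claw condition then
  -- matches every third label.
  have htwo : ∀ (v : V) (a b : ℕ), a ≠ b → LabelIncident G Δ v a → LabelIncident G Δ v b →
      ∃ v', ∀ a, LabelIncident G Δ v a ↔ LabelIncident G' Δ' v' a := by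
    intro v a b hab ha hb
    obtain ⟨v', ha', hb'⟩ := (h₂ a b hab).1 ⟨v, ha, hb⟩
    refine ⟨v', fun c => ?_⟩
    by_cases hac : a = c
    · subst hac; exact iff_of_true ha ha'
    by_cases hbc : b = c
    · subst hbc; exact iff_of_true hb hb'
    constructor
    · intro hc
      obtain ⟨w, hwa, hwb, hwc⟩ := (h₃ a b c hab hac hbc).1 ⟨v, ha, hb, hc⟩
      by_cases hw : w = v'
      · rwa [← hw]
      · exact absurd (hwa.label_eq hΔ' hw ha' hwb hb') hab
    · intro hc
      obtain ⟨w, hwa, hwb, hwc⟩ := (h₃ a b c hab hac hbc).2 ⟨v', ha', hb', hc⟩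
      by_cases hw : w = v
      · rwa [← hw]
      · exact absurd (hwa.label_eq hΔ hw ha hwb hb) hab
  have hnt : Nontrivial V := Fintype.one_lt_card_iff_nontrivial.1 (by omega)
  obtain ⟨w, hvw⟩ := hG.preconnected.exists_adj_of_nontrivial v
  set a := Δ s(v, w) with ha
  have hva : LabelIncident G Δ v a := labelIncident_left hvw
  have hwa : LabelIncident G Δ w a := labelIncident_right hvw
  by_cases hv : ∃ b, a ≠ b ∧ LabelIncident G Δ v b
  · obtain ⟨b, hab, hb⟩ := hv
    exact htwo v a b hab hva hb
  push Not at hv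
  have hv' : ∀ b, LabelIncident G Δ v b → b = a := fun b hb => by
    by_contra hba
    exact hv b (Ne.symm hba) hb
  -- Now `v` is a leaf. Its neighbour `w` carries a second label, as otherwise `v` and `w` would be
  -- all of `V`. So `w'` is known, and `v'` is the other end of the edge labelled `a`.
  obtain ⟨b, hab, hwb⟩ : ∃ b, a ≠ b ∧ LabelIncident G Δ w b := by
    by_contra! hw
    have hw' : ∀ b, LabelIncident G Δ w b → a = b := fun b hb => by
      by_contra hba
      exact hw b hba hb
    refine not_two_closed hG hV (u := v) (v := w) (fun x hx => ?_) (fun x hx => ?_)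
    · have h1 := (labelIncident_right (Δ := Δ) hx)
      rw [hv' _ (labelIncident_left hx)] at h1
      exact (h1.eq_or_eq hΔ hvw rfl).resolve_left hx.ne'
    · have h1 := (labelIncident_right (Δ := Δ) hx)
      rw [← hw' _ (labelIncident_left hx)] at h1
      exact (h1.eq_or_eq hΔ hvw rfl).resolve_right hx.ne'
  obtain ⟨w', hw'⟩ := htwo w a b hab hwa hwb
  obtain ⟨v', hwv', hva'⟩ := (hw' a).1 hwa
  have hv'a : LabelIncident G' Δ' v' a := hva' ▸ labelIncident_right hwv'
  refine ⟨v', fun c => ⟨fun hc => (hv' c hc) ▸ hv'a, fun hc => ?_⟩⟩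
  by_cases hca : a = c
  · exact hca ▸ hva
  -- In `G` the labels `a` and `c` meet at `v` or at `w`. In the second case both would lie on `w'`
  -- and on `v'`, which forces `c = a`.
  obtain ⟨z, hza, hzc⟩ := (h₂ a c hca).2 ⟨v', hv'a, hc⟩
  rcases hza.eq_or_eq hΔ hvw rfl with rfl | rfl
  · exact hzc
  · exact absurd (((hw' a).1 hwa).label_eq hΔ' hwv'.ne hv'a ((hw' c).1 hzc) hc) hca

theorem diffusionPairIso_of_isLabelEigenvalue_iff (hG : G.Connected)
    (hcard : Fintype.card V = Fintype.card V')
    (hΔ : Set.InjOn Δ G.edgeSet) (hΔ' : Set.InjOn Δ' G'.edgeSet)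
    (h : ∀ T μ, IsLabelEigenvalue G Δ T μ ↔ IsLabelEigenvalue G' Δ' T μ) :
    DiffusionPairIso G Δ G' Δ' := by
  have h₁ : ∀ a, (∃ v, LabelIncident G Δ v a) ↔ ∃ v, LabelIncident G' Δ' v a := fun a => by
    rw [exists_labelIncident_iff hΔ, exists_labelIncident_iff hΔ', h]
  have h₂ : ∀ a b, a ≠ b → ((∃ v, LabelIncident G Δ v a ∧ LabelIncident G Δ v b) ↔
      ∃ v, LabelIncident G' Δ' v a ∧ LabelIncident G' Δ' v b) := by
    intro a b hab
    by_cases hex : (∃ v, LabelIncident G Δ v a) ∧ ∃ v, LabelIncident G Δ v b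
    · rw [exists_common_vertex_iff hΔ hab hex.1 hex.2, exists_common_vertex_iff hΔ' hab
        ((h₁ a).1 hex.1) ((h₁ b).1 hex.2), h]
    · refine iff_of_false ?_ ?_
      · rintro ⟨v, ha, hb⟩
        exact hex ⟨⟨v, ha⟩, ⟨v, hb⟩⟩
      · rintro ⟨v, ha, hb⟩
        exact hex ⟨(h₁ a).2 ⟨v, ha⟩, (h₁ b).2 ⟨v, hb⟩⟩
  have h₃ : ∀ a b c, a ≠ b → a ≠ c → b ≠ c →
      ((∃ v, LabelIncident G Δ v a ∧ LabelIncident G Δ v b ∧ LabelIncident G Δ v c) ↔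
        ∃ v, LabelIncident G' Δ' v a ∧ LabelIncident G' Δ' v b ∧ LabelIncident G' Δ' v c) := by
    intro a b c hab hac hbc
    constructor
    · rintro ⟨v, ha, hb, hc⟩
      rw [exists_common_vertex_three_iff hΔ' hab hac hbc ((h₂ a b hab).1 ⟨v, ha, hb⟩)
        ((h₂ b c hbc).1 ⟨v, hb, hc⟩) ((h₂ a c hac).1 ⟨v, ha, hc⟩), ← h,
        ← exists_common_vertex_three_iff hΔ hab hac hbc ⟨v, ha, hb⟩ ⟨v, hb, hc⟩ ⟨v, ha, hc⟩]
      exact ⟨v, ha, hb, hc⟩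
    · rintro ⟨v, ha, hb, hc⟩
      rw [exists_common_vertex_three_iff hΔ hab hac hbc ((h₂ a b hab).2 ⟨v, ha, hb⟩)
        ((h₂ b c hbc).2 ⟨v, hb, hc⟩) ((h₂ a c hac).2 ⟨v, ha, hc⟩), h,
        ← exists_common_vertex_three_iff hΔ' hab hac hbc ⟨v, ha, hb⟩ ⟨v, hb, hc⟩ ⟨v, ha, hc⟩]
      exact ⟨v, ha, hb, hc⟩
  obtain ⟨φ, hφ⟩ : ∃ φ : V ≃ V', ∀ v a, LabelIncident G Δ v a ↔ LabelIncident G' Δ' (φ v) a := by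
    -- On at most two vertices every edge contains all of them, so labels do not tell vertices apart
    -- and any bijection will do.
    rcases le_or_gt (Fintype.card V) 2 with hV | hV
    · refine ⟨Fintype.equivOfCardEq hcard, fun v a => ?_⟩
      rw [labelIncident_iff_of_card_le_two hV, labelIncident_iff_of_card_le_two (hcard ▸ hV), h₁]
    · choose φ hφ using exists_labelIncident_iff_of_card hG hV hΔ hΔ' h₂ h₃
      have hinj : Function.Injective φ := fun u v huv =>
        eq_of_labelIncident_iff hG hV hΔ fun a => by rw [hφ u, hφ v, huv]
      exact ⟨Equiv.ofBijective φ ((Fintype.bijective_iff_injective_and_card φ).2 ⟨hinj, hcard⟩), hφ⟩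
  have hlab : ∀ u v, G.Adj u v → G'.Adj (φ u) (φ v) ∧ Δ' s(φ u, φ v) = Δ s(u, v) := fun u v huv =>
    ((hφ u _).1 (labelIncident_left huv)).adj_of_ne hΔ' (φ.injective.ne huv.ne)
      ((hφ v _).1 (labelIncident_right huv))
  refine ⟨⟨φ, fun {u v} => ⟨fun huv => ?_, fun huv => (hlab u v huv).1⟩⟩, fun u v huv =>
    (hlab u v huv).2⟩
  exact (((hφ u _).2 (labelIncident_left huv)).adj_of_ne hΔ (fun h => huv.ne (by rw [h]))
    ((hφ v _).2 (labelIncident_right huv))).1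

end Reconstruction

end Incidence

/-! ### Sum-freeness, uniform constants and the final assembly -/

section Reconstruction

open scoped Classical
open Matrix

variable {V V' : Type*} [Fintype V] [Fintype V']

/-- A proper multiple of a label would be a repeated sum of it. Besides positivity, this is all of
sum-freeness that the argument needs; it includes distinctness. -/
theorem SumFreeLabels.eq_of_dvd {ι : Type*} {E : Set ι} {α : ι → ℕ} (h : SumFreeLabels E α)
    {i j : ι} (hi : i ∈ E) (hj : j ∈ E) (hij : α i ∣ α j) : i = j := by
  by_contra hne
  obtain ⟨k, hk⟩ := hij
  have hk0 : k ≠ 0 := by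
    rintro rfl
    exact (h j hj).1.ne' (by simpa using hk)
  refine (h j hj).2 (Multiset.replicate k i) ?_ (fun l hl => ?_) ?_
  · exact fun h0 => hk0 (by simpa using congrArg Multiset.card h0)
  · rw [Multiset.eq_of_mem_replicate hl]
    exact ⟨hi, hne⟩
  · rw [hk, Multiset.map_replicate, Multiset.sum_replicate, smul_eq_mul, mul_comm]

theorem SumFreeLabels.injOn {ι : Type*} {E : Set ι} {α : ι → ℕ} (h : SumFreeLabels E α) :
    Set.InjOn α E :=
  fun _ hi _ hj hij => h.eq_of_dvd hi hj (dvd_of_eq hij)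

theorem SpectralSeparation.congr {G : SimpleGraph V} {Δ Δ' : Sym2 V → ℕ} {D : ℝ}
    (h : SpectralSeparation G Δ D) (hΔ : ∀ e ∈ G.edgeSet, Δ e = Δ' e) :
    SpectralSeparation G Δ' D := by
  have hL : ∀ y, realLaplacian G Δ y = realLaplacian G Δ' y := fun y =>
    edgeLaplacian_congr fun e he => by rw [hΔ e he]
  refine ⟨h.one_le, ?_, ?_, ?_⟩
  · simpa only [hL] using h.le_of_le_one
  · simpa only [hL] using h.nodup
  · intro y hy μ hμ
    rw [← hL] at hμ
    refine (h.comparable y hy μ hμ).imp_right ?_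
    rintro ⟨e, he, h1⟩
    exact ⟨e, he, by rwa [← hΔ e he]⟩

theorem eventually_spectralSeparation {G : SimpleGraph V} (hG : G.Connected) {Δ : Sym2 V → ℕ}
    (hpos : ∀ e ∈ G.edgeSet, 0 < Δ e) (hΔ : Set.InjOn Δ G.edgeSet) :
    ∀ᶠ D in Filter.atTop, SpectralSeparation G Δ D :=
  Filter.eventually_atTop.2 (exists_spectralSeparation hG hpos hΔ)

variable (V) in
/-- The constant of separation is uniform over all labellings by elements of a finite set. -/
theorem eventually_forall_isLabelling {A : Finset ℕ} (hA : ∀ a ∈ A, 0 < a) :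
    ∀ᶠ D in Filter.atTop, ∀ (G : SimpleGraph V) (Δ : Sym2 V → ℕ), G.Connected →
      IsLabelling (A : Set ℕ) G Δ → SpectralSeparation G Δ D := by
  -- There are infinitely many `Δ`, but only the values on edges matter, and these are bounded by
  -- `A.sup id`. With values in a `Fin` type the family is finite, and the constants can be made
  -- uniform.
  have hfin : ∀ᶠ D in Filter.atTop, ∀ (G : SimpleGraph V) (f : Sym2 V → Fin (A.sup id + 1)),
      G.Connected → (∀ e ∈ G.edgeSet, 0 < (f e : ℕ)) → Set.InjOn (fun e => (f e : ℕ)) G.edgeSet →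
        SpectralSeparation G (fun e => (f e : ℕ)) D := by
    simp only [Filter.eventually_all]
    exact fun G f hG hpos hf => eventually_spectralSeparation hG hpos hf
  filter_upwards [hfin] with D hD G Δ hG hΔ
  let f : Sym2 V → Fin (A.sup id + 1) := fun e =>
    if h : e ∈ G.edgeSet then ⟨Δ e, Nat.lt_succ_of_le (Finset.le_sup (f := id) (hΔ.1 h))⟩ else 0
  have hf : ∀ e ∈ G.edgeSet, (f e : ℕ) = Δ e := fun e he => by simp only [f, dif_pos he]
  refine (hD G f hG (fun e he => ?_) fun e he e' he' hee => ?_).congr hf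
  · rw [hf e he]
    exact hA _ (hΔ.1 he)
  · simp only [hf e he, hf e' he'] at hee
    exact hΔ.2 he he' hee

/-- The bound is on `p` instead of `q`, which makes it uniform in `K`, since `p ≤ q`. -/
theorem spectralPolynomial_eq_of_laplacianSpec_eq {K : Type*} [NontriviallyNormedField K]
    [IsUltrametricDist K] [ProperSpace K] [MeasurableSpace K] [BorelSpace K]
    (hK : IsNormalized K) {p : ℕ} (hp : p.Prime) (hpK : ‖(p : K)‖ < 1)
    {χ : AddChar K Circle} (hχ : Continuous χ) (hχ1 : ∃ x, χ x ≠ 1)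
    {G : SimpleGraph V} {Δ : Sym2 V → ℕ} {G' : SimpleGraph V'} {Δ' : Sym2 V' → ℕ}
    (hG : G.Connected) (hG' : G'.Connected) {D : ℝ}
    (hD : SpectralSeparation G Δ D) (hD' : SpectralSeparation G' Δ' D) (hDp : D * D < p)
    {A : Finset ℕ} (hpos : ∀ a ∈ A, 0 < a) (hA : ∀ a ∈ A, ∀ b ∈ A, a ∣ b → a = b)
    (hΔ : ∀ e ∈ G.edgeSet, Δ e ∈ A) (hΔ' : ∀ e ∈ G'.edgeSet, Δ' e ∈ A)
    (h : laplacianSpec χ G Δ = laplacianSpec χ G' Δ') :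
    spectralPolynomial G Δ = spectralPolynomial G' Δ' := by
  have hpq : p ≤ residueCard K := le_residueCard hK hp hpK
  have hq : 1 < residueCard K := hp.one_lt.trans_le hpq
  obtain ⟨δ, hδ0, hδ⟩ := exists_conductor hχ hχ1
  have := hG.nonempty
  have := hG'.nonempty
  refine spectralPolynomial_eq_of_powerSpectrum_eq hD hD' (q := residueCard K)
    (hDp.trans_le (by exact_mod_cast hpq)) hpos hA hΔ hΔ' ?_
  ext μ
  constructor
  · intro hμ
    have h1 := laplacianSpec_ne_zero_of_mem_powerSpectrum hK hq hδ hδ0 hχ hμ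
    rw [h] at h1
    exact mem_powerSpectrum_of_laplacianSpec_ne_zero hG' hK hq hδ hδ0 hχ h1
  · intro hμ
    have h1 := laplacianSpec_ne_zero_of_mem_powerSpectrum hK hq hδ hδ0 hχ hμ
    rw [← h] at h1
    exact mem_powerSpectrum_of_laplacianSpec_ne_zero hG hK hq hδ hδ0 hχ h1

theorem diffusionPairIso_of_spectralPolynomial_eq {G : SimpleGraph V} {Δ : Sym2 V → ℕ}
    {G' : SimpleGraph V'} {Δ' : Sym2 V' → ℕ} {A : Finset ℕ} (hG : G.Connected)
    (h : IsLabelling (A : Set ℕ) G Δ) (h' : IsLabelling (A : Set ℕ) G' Δ')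
    (hA : DistinctSubsetSums (A : Set ℕ))
    (hP : spectralPolynomial G Δ = spectralPolynomial G' Δ') : DiffusionPairIso G Δ G' Δ' := by
  refine diffusionPairIso_of_isLabelEigenvalue_iff hG (card_eq_of_spectralPolynomial_eq hP) h.2
    h'.2 fun T μ => ?_
  rw [isLabelEigenvalue_iff, isLabelEigenvalue_iff,
    charpoly_eq_of_spectralPolynomial_eq h h' hA hP fun a => if a ∈ T then 1 else 0]

end Reconstruction

end PadicLaplacian

/-! ### The two reconstruction statements -/

theorem mainTheorem2 {V V' : Type*} [Fintype V] [Fintype V'] :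
    -- the labels are attached to the pairs of vertices
    (∀ Δ : Sym2 V → ℕ, PadicLaplacian.SumFreeLabels {e : Sym2 V | ¬ e.IsDiag} Δ →
      ∃ p₀ : ℕ, ∀ p : ℕ, p.Prime → p₀ ≤ p →
        ∀ (K : Type*) [NontriviallyNormedField K] [IsUltrametricDist K] [ProperSpace K]
          [MeasurableSpace K] [BorelSpace K],
          PadicLaplacian.IsNormalized K → ‖(p : K)‖ < 1 →
        ∀ χ : AddChar K Circle, Continuous χ → (∃ x, χ x ≠ 1) →
        ∀ G G' : SimpleGraph V, G.Connected → G'.Connected →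
          PadicLaplacian.laplacianSpec χ G Δ = PadicLaplacian.laplacianSpec χ G' Δ → G = G') ∧
    -- only the set of labels is fixed, their places on the edges are unknown
    (∀ A : Finset ℕ, PadicLaplacian.SumFreeLabels (A : Set ℕ) id →
      ∃ p₀ : ℕ, ∀ p : ℕ, p.Prime → p₀ ≤ p →
        ∀ (K : Type*) [NontriviallyNormedField K] [IsUltrametricDist K] [ProperSpace K]
          [MeasurableSpace K] [BorelSpace K],
          PadicLaplacian.IsNormalized K → ‖(p : K)‖ < 1 →
        ∀ χ : AddChar K Circle, Continuous χ → (∃ x, χ x ≠ 1) →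
        ∀ (G : SimpleGraph V) (Δ : Sym2 V → ℕ) (G' : SimpleGraph V') (Δ' : Sym2 V' → ℕ),
          G.Connected → G'.Connected →
          PadicLaplacian.IsLabelling A G Δ → PadicLaplacian.IsLabelling A G' Δ' →
          PadicLaplacian.laplacianSpec χ G Δ = PadicLaplacian.laplacianSpec χ G' Δ' →
          PadicLaplacian.spectralPolynomial G Δ = PadicLaplacian.spectralPolynomial G' Δ' ∧
            (PadicLaplacian.DistinctSubsetSums (A : Set ℕ) →
              PadicLaplacian.DiffusionPairIso G Δ G' Δ')) := by
  classical
  refine ⟨fun Δ hΔ => ?_, fun A hA => ?_⟩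
  · have hdiag : ∀ (G : SimpleGraph V), ∀ e ∈ G.edgeSet, e ∈ {e : Sym2 V | ¬ e.IsDiag} :=
      fun G e he => G.not_isDiag_of_mem_edgeSet he
    -- There are finitely many graphs on `V`, so one `D` serves them all, and `p₀` is any integer
    -- above `D * D`.
    have hev : ∀ᶠ D in Filter.atTop, ∀ G : SimpleGraph V, G.Connected →
        PadicLaplacian.SpectralSeparation G Δ D := by
      simp only [Filter.eventually_all]
      exact fun G hG => PadicLaplacian.eventually_spectralSeparation hG
        (fun e he => (hΔ e (hdiag G e he)).1) (hΔ.injOn.mono (hdiag G))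
    obtain ⟨D, hD⟩ := hev.exists
    obtain ⟨p₀, hp₀⟩ := exists_nat_gt (D * D)
    refine ⟨p₀, fun p hp hpp K _ _ _ _ _ hK hpK χ hχ hχ1 G G' hG hG' h => ?_⟩
    have := hG.nonempty
    let A : Finset ℕ := (Finset.univ.filter fun e : Sym2 V => ¬ e.IsDiag).image Δ
    have hmem : ∀ {a}, a ∈ A → ∃ e, ¬ e.IsDiag ∧ Δ e = a := fun {a} ha => by
      simpa [A] using ha
    have hAΔ : ∀ (G : SimpleGraph V), ∀ e ∈ G.edgeSet, Δ e ∈ A := fun G e he =>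
      Finset.mem_image_of_mem Δ (by simpa using hdiag G e he)
    refine PadicLaplacian.graph_eq_of_spectralPolynomial_eq hΔ.injOn
      (PadicLaplacian.spectralPolynomial_eq_of_laplacianSpec_eq hK hp hpK hχ hχ1 hG hG'
        (hD G hG) (hD G' hG') (hp₀.trans_le (by exact_mod_cast hpp)) (A := A) ?_ ?_
        (hAΔ G) (hAΔ G') h)
    · intro a ha
      obtain ⟨e, he, rfl⟩ := hmem ha
      exact (hΔ e he).1
    · intro a ha b hb hab
      obtain ⟨e, he, rfl⟩ := hmem ha
      obtain ⟨e', he', rfl⟩ := hmem hb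
      rw [hΔ.eq_of_dvd he he' hab]
  · have hpos : ∀ a ∈ A, 0 < a := fun a ha => (hA a ha).1
    obtain ⟨D, hD, hD'⟩ := ((PadicLaplacian.eventually_forall_isLabelling V hpos).and
      (PadicLaplacian.eventually_forall_isLabelling V' hpos)).exists
    obtain ⟨p₀, hp₀⟩ := exists_nat_gt (D * D)
    refine ⟨p₀, fun p hp hpp K _ _ _ _ _ hK hpK χ hχ hχ1 G Δ G' Δ' hG hG' hΔ hΔ' h => ?_⟩
    have hP := PadicLaplacian.spectralPolynomial_eq_of_laplacianSpec_eq hK hp hpK hχ hχ1 hG hG'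
      (hD G Δ hG hΔ) (hD' G' Δ' hG' hΔ') (hp₀.trans_le (by exact_mod_cast hpp)) hpos
      (fun a ha b hb hab => hA.eq_of_dvd ha hb hab) (fun e he => hΔ.1 he) (fun e he => hΔ'.1 he) h
    exact ⟨hP, fun hsum =>
      PadicLaplacian.diffusionPairIso_of_spectralPolynomial_eq hG hΔ hΔ' hsum hP⟩
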